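/- Let $X$ be a complex manifold of dimension $n\ge 1$, let $p\in X$, and let $D\subset X$ be (the germ at $p\in D$ of) a reduced divisor with reduced local equation $h\in\mathcal O_{X,p}\cong\mathbb C\{x_1,\dots,x_n\}$, $h(p)=0$. Assume that $D$ is free at $p$, i.e. that the module $\Theta(-\log D)_p$ of germs of holomorphic vector fields $\delta$ with $\delta(h)\in(h)$ is free of rank $n$ over $\mathcal O_{X,p}$, and that $D$ is strongly Koszul at $p$: for any basis $\delta_1,\dots,\delta_n$ of $\Theta(-\log D)_p$, with $\delta_i(h)=\alpha_i h$, the sequence $$h,\ \sigma(\delta_1)-\alpha_1 s,\ \dots,\ \sigma(\delta_n)-\alpha_n s$$ is regular in $\operatorname{Gr}^T_\bullet\mathcal D_{X,p}[s]=\mathcal O_{X,p}[\sigma(\partial_{x_1}),\dots,\sigma(\partial_{x_n}),s]$ (the graded ring for the total order filtration, where vector fields and $s$ have order $1$; $\sigma$ denotes the symbol). Let $\delta_1,\dots,\delta_{n-1},\chi$ be a basis of $\Theta(-\log D)_p$ with $\delta_i(h)=0$ for all $i$ and $\chi(h)=h$. Write $\mathcal D:=\mathcal D_{\mathbb C_t\times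 X,(0,p)}$ for the ring of germs of linear differential operators with holomorphic coefficients on $\mathbb C_t\times X$ at $(0,p)$, let $F_l\mathcal D$ $(l\in\mathbb Z)$ be the operators of order $\le l$ (so $F_l\mathcal D=0$ for $l<0$), and for $k\in\mathbb Z$ let $$V^k\mathcal D=\{P\in\mathcal D \mid P(\mathcal I^i)\subset\mathcal I^{i+k}\text{ for all } i\in\mathbb Z\},\qquad \mathcal I=(t),\quad \mathcal I^i=\mathcal O_{\mathbb C_t\times X,(0,p)}\text{ for } i\le 0 .$$ Let $I(h)\subset\mathcal D$ be the left ideal generated by $t-h,\ \delta_1,\dots,\delta_{n-1},\ \chi+\partial_t t+1$, let $N(h)=\mathcal D/I(h)$, and let $F^{\operatorname{ord}}_l N(h)$ and $V^k_{\operatorname{ind}}N(h)$ be the images of $F_l\mathcal D$ and $V^k\mathcal D$ in $N(h)$. Then for all $k,l\in\mathbb Z$ the canonical map $$F_l\mathcal D\cap V^k\mathcal D\longrightarrow F^{\operatorname{ord}}_l N(h)\cap V^k_{\operatorname{ind}}N(h)$$ is surjective. -/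

import Mathlib

noncomputable section

namespace SKFree

open MvPowerSeries

/-! ### Convergent power series -/

/-- A power series converges (absolutely) on some polydisc about the origin. -/
def IsConvergent {σ : Type} (f : MvPowerSeries σ ℂ) : Prop :=
  ∃ r : ℝ, 0 < r ∧ Summable fun a : σ →₀ ℕ => ‖coeff a f‖ * r ^ a.degree

theorem summable_shrink {σ : Type} {f : MvPowerSeries σ ℂ} {r s : ℝ} (hs : 0 ≤ s) (hsr : s ≤ r)
    (h : Summable fun a : σ →₀ ℕ => ‖coeff a f‖ * r ^ a.degree) :
    Summable fun a : σ →₀ ℕ => ‖coeff a f‖ * s ^ a.degree :=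
  h.of_nonneg_of_le (fun _ => mul_nonneg (norm_nonneg _) (pow_nonneg hs _))
    (fun _ => mul_le_mul_of_nonneg_left (pow_le_pow_left₀ hs hsr _) (norm_nonneg _))

theorem summable_coeff_mul {σ : Type} {f g : MvPowerSeries σ ℂ} {q : ℝ} (hq : 0 ≤ q)
    (hf : Summable fun a : σ →₀ ℕ => ‖coeff a f‖ * q ^ a.degree)
    (hg : Summable fun a : σ →₀ ℕ => ‖coeff a g‖ * q ^ a.degree) :
    Summable fun a : σ →₀ ℕ => ‖coeff a (f * g)‖ * q ^ a.degree := by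
  classical
  set F : (σ →₀ ℕ) → ℝ := fun a => ‖coeff a f‖ * q ^ a.degree with hF
  set G : (σ →₀ ℕ) → ℝ := fun a => ‖coeff a g‖ * q ^ a.degree with hG
  have nF : 0 ≤ F := fun a => mul_nonneg (norm_nonneg _) (pow_nonneg hq _)
  have nG : 0 ≤ G := fun a => mul_nonneg (norm_nonneg _) (pow_nonneg hq _)
  have hFG : Summable fun x : (σ →₀ ℕ) × (σ →₀ ℕ) => F x.1 * G x.2 :=
    Summable.mul_of_nonneg hf hg nF nG
  have key := summable_sum_mul_antidiagonal_of_summable_mul hFG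
  have bound : ∀ a : σ →₀ ℕ, ‖coeff a (f * g)‖ * q ^ a.degree ≤
      ∑ p ∈ Finset.HasAntidiagonal.antidiagonal a, F p.1 * G p.2 := by
    intro a
    have h1 : ‖coeff a (f * g)‖ ≤
        ∑ p ∈ Finset.HasAntidiagonal.antidiagonal a, ‖coeff p.1 f * coeff p.2 g‖ := by
      rw [coeff_mul]
      exact norm_sum_le _ _
    refine (mul_le_mul_of_nonneg_right h1 (pow_nonneg hq _)).trans (le_of_eq ?_)
    rw [Finset.sum_mul]
    refine Finset.sum_congr rfl fun p hp => ?_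
    have h2 : a.degree = p.1.degree + p.2.degree := by
      rw [← map_add, Finset.HasAntidiagonal.mem_antidiagonal.1 hp]
    rw [norm_mul, h2, pow_add, hF, hG]
    ring
  exact key.of_nonneg_of_le (fun a => mul_nonneg (norm_nonneg _) (pow_nonneg hq _)) bound

theorem IsConvergent.mul {σ : Type} {f g : MvPowerSeries σ ℂ} (hf : IsConvergent f)
    (hg : IsConvergent g) : IsConvergent (f * g) := by
  obtain ⟨r, hr, hf⟩ := hf
  obtain ⟨s, hs, hg⟩ := hg
  have hm : 0 < min r s := lt_min hr hs
  exact ⟨min r s, hm, summable_coeff_mul hm.le (summable_shrink hm.le (min_le_left r s) hf)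
    (summable_shrink hm.le (min_le_right r s) hg)⟩

theorem IsConvergent.add {σ : Type} {f g : MvPowerSeries σ ℂ} (hf : IsConvergent f)
    (hg : IsConvergent g) : IsConvergent (f + g) := by
  obtain ⟨r, hr, hf⟩ := hf
  obtain ⟨s, hs, hg⟩ := hg
  have hm : 0 < min r s := lt_min hr hs
  refine ⟨min r s, hm, ?_⟩
  have hf' := summable_shrink hm.le (min_le_left r s) hf
  have hg' := summable_shrink hm.le (min_le_right r s) hg
  generalize min r s = q at hm hf' hg'
  refine (hf'.add hg').of_nonneg_of_le
    (fun a => mul_nonneg (norm_nonneg _) (pow_nonneg hm.le _)) (fun a => ?_)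
  rw [map_add, ← add_mul]
  exact mul_le_mul_of_nonneg_right (norm_add_le _ _) (pow_nonneg hm.le _)

theorem isConvergent_monomial {σ : Type} (b : σ →₀ ℕ) (c : ℂ) :
    IsConvergent (monomial b c : MvPowerSeries σ ℂ) := by
  classical
  refine ⟨1, one_pos, summable_of_ne_finset_zero (s := {b}) fun a ha => ?_⟩
  have : a ≠ b := by simpa using ha
  simp [coeff_monomial, this]

theorem IsConvergent.pderiv {σ : Type} {f : MvPowerSeries σ ℂ} (hf : IsConvergent f) (i : σ) :
    IsConvergent (MvPowerSeries.pderiv ℂ i f) := by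
  obtain ⟨r, hr, hf⟩ := hf
  refine ⟨r / 2, by positivity, ?_⟩
  have h1 := (hf.comp_injective (add_left_injective (Finsupp.single i 1))).mul_right (1 / r)
  refine h1.of_nonneg_of_le
    (fun a => mul_nonneg (norm_nonneg _) (pow_nonneg (by positivity) _)) (fun a => ?_)
  have h2 : ((a i : ℝ) + 1) ≤ 2 ^ a.degree := by
    have h3 : a i + 1 ≤ 2 ^ a.degree :=
      (Nat.succ_le_succ (Finsupp.le_degree i a)).trans a.degree.lt_two_pow_self
    exact_mod_cast h3
  have h4 : ‖((a i : ℂ) + 1)‖ = (a i : ℝ) + 1 := by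
    have : ((a i : ℂ) + 1) = ((a i + 1 : ℕ) : ℂ) := by push_cast; rfl
    rw [this, Complex.norm_natCast]; push_cast; rfl
  have h5 : (a + Finsupp.single i 1).degree = a.degree + 1 := by
    rw [map_add, Finsupp.degree_single]
  simp only [coeff_pderiv, Function.comp, norm_mul, h4, h5]
  have h6 : r ^ (a.degree + 1) * (1 / r) = r ^ a.degree := by field_simp; ring
  rw [mul_assoc, mul_assoc, h6]
  refine mul_le_mul_of_nonneg_left ?_ (norm_nonneg _)
  calc ((a i : ℝ) + 1) * (r / 2) ^ a.degree ≤ 2 ^ a.degree * (r / 2) ^ a.degree :=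
        mul_le_mul_of_nonneg_right h2 (pow_nonneg (by positivity) _)
    _ = r ^ a.degree := by rw [← mul_pow]; congr 1; ring

theorem IsConvergent.rename_some {σ : Type} {f : MvPowerSeries σ ℂ} (hf : IsConvergent f) :
    IsConvergent (rename (Function.Embedding.some : σ ↪ Option σ) f) := by
  classical
  obtain ⟨r, hr, hf⟩ := hf
  refine ⟨r, hr, ?_⟩
  refine ((Finsupp.embDomain_injective (M := ℕ)
    (Function.Embedding.some : σ ↪ Option σ)).summable_iff ?_).1 ?_
  · intro a ha
    rw [coeff_rename_eq_zero, norm_zero, zero_mul]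
    rintro ⟨b, rfl⟩
    exact ha ⟨b, by rw [Finsupp.embDomain_eq_mapDomain]⟩
  · refine hf.congr fun a => ?_
    simp only [Function.comp, coeff_embDomain_rename]
    rw [Finsupp.embDomain_eq_mapDomain, Finsupp.degree_mapDomain]

/-- The ring `ℂ{x_i : i ∈ σ}` of germs at the origin of holomorphic functions, as the ring of those
power series that converge absolutely on some polydisc about the origin. -/
def convergentSeries (σ : Type) : Subalgebra ℂ (MvPowerSeries σ ℂ) where
  carrier := {f | IsConvergent f}
  mul_mem' := IsConvergent.mul
  add_mem' := IsConvergent.add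
  algebraMap_mem' c := isConvergent_monomial 0 c

/-- The ring of germs of holomorphic functions, as a type. -/
def Germs (σ : Type) : Type := convergentSeries σ

instance (σ : Type) : CommRing (Germs σ) := inferInstanceAs (CommRing (convergentSeries σ))

instance (σ : Type) : Algebra ℂ (Germs σ) := inferInstanceAs (Algebra ℂ (convergentSeries σ))

/-- The power series of a germ. -/
def Germs.series {σ : Type} (f : Germs σ) : MvPowerSeries σ ℂ := (convergentSeries σ).val f

theorem Germs.isConvergent {σ : Type} (f : Germs σ) : IsConvergent f.series := f.2

/-- The germ of the coordinate function `x_i`. -/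
def coord {σ : Type} (i : σ) : Germs σ :=
  ⟨X i, isConvergent_monomial (Finsupp.single i 1) 1⟩

/-- The partial derivative `∂/∂x_i` of germs. -/
def partialDeriv {σ : Type} (i : σ) : Module.End ℂ (Germs σ) where
  toFun f := ⟨pderiv ℂ i f.series, f.isConvergent.pderiv i⟩
  map_add' f g := Subtype.ext (map_add (pderiv ℂ i) f.series g.series)
  map_smul' c f := Subtype.ext (Derivation.map_smul (pderiv ℂ i) c f.series)

/-- Pull-back of germs on `X` along the projection `ℂ_t × X → X`.  The coordinates of `ℂ_t × X`
are indexed by `Option σ`, with `none` standing for `t` and `some i` for `x_i`. -/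
def pullback {σ : Type} (f : Germs σ) : Germs (Option σ) :=
  ⟨rename (Function.Embedding.some : σ ↪ Option σ) f.series, f.isConvergent.rename_some⟩

/-! ### Differential operators -/

/-- The ring `𝒟` of germs of linear differential operators with holomorphic coefficients: the
algebra of operators on germs generated by multiplications by germs and partial derivatives. -/
def diffOps (σ : Type) : Subalgebra ℂ (Module.End ℂ (Germs σ)) :=
  Algebra.adjoin ℂ (Set.range (LinearMap.mulLeft ℂ : Germs σ → Module.End ℂ (Germs σ)) ∪
    Set.range (partialDeriv : σ → Module.End ℂ (Germs σ)))

/-- The ring of differential operators, as a type. -/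
def DiffOp (σ : Type) : Type := diffOps σ

instance (σ : Type) : Ring (DiffOp σ) := inferInstanceAs (Ring (diffOps σ))

instance (σ : Type) : Algebra ℂ (DiffOp σ) := inferInstanceAs (Algebra ℂ (diffOps σ))

/-- The action of differential operators on germs. -/
def DiffOp.act {σ : Type} : DiffOp σ →ₐ[ℂ] Module.End ℂ (Germs σ) := (diffOps σ).val

/-- A germ as a differential operator of order zero. -/
def ofGerm {σ : Type} (f : Germs σ) : DiffOp σ :=
  ⟨LinearMap.mulLeft ℂ f, Algebra.subset_adjoin (Or.inl ⟨f, rfl⟩)⟩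

/-- The operator `∂/∂x_i`. -/
def del {σ : Type} (i : σ) : DiffOp σ :=
  ⟨partialDeriv i, Algebra.subset_adjoin (Or.inr ⟨i, rfl⟩)⟩

/-- `F_l 𝒟`, the operators of order at most `l`: spanned by the operators
`f ∂_{i_1} ⋯ ∂_{i_j}` with `j ≤ l`. In particular it is `0` for `l < 0`. -/
def orderFiltration (σ : Type) (l : ℤ) : Submodule ℂ (DiffOp σ) :=
  Submodule.span ℂ
    {P | ∃ (f : Germs σ) (L : List σ), (L.length : ℤ) ≤ l ∧ P = ofGerm f * (L.map del).prod}

/-- The `i`-th power of the ideal of the smooth divisor `{x_c = 0}`, for `i : ℤ`, with the usual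
convention that it is the whole ring for `i ≤ 0`. -/
def divisorIdealPow {σ : Type} (c : σ) (i : ℤ) : Ideal (Germs σ) :=
  Ideal.span {coord c} ^ i.toNat

/-- `V^k 𝒟 = {P | P 𝓘^i ⊆ 𝓘^{i+k} for all i}`, where `𝓘` is the ideal of `{x_c = 0}`. -/
def vFiltration {σ : Type} (c : σ) (k : ℤ) : Submodule ℂ (DiffOp σ) where
  carrier := {P | ∀ i : ℤ, ∀ f ∈ divisorIdealPow c i, P.act f ∈ divisorIdealPow c (i + k)}
  add_mem' {P Q} hP hQ i f hf := by
    rw [map_add]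
    exact add_mem (hP i f hf) (hQ i f hf)
  zero_mem' i f _ := by
    rw [map_zero]
    exact zero_mem (divisorIdealPow c (i + k))
  smul_mem' a _ hP i f hf := by
    rw [map_smul]
    exact Submodule.smul_of_tower_mem (divisorIdealPow c (i + k)) a (hP i f hf)

/-! ### Vector fields, free and strongly Koszul divisors -/

/-- Germs of holomorphic vector fields `∑ i, θ i ∂/∂x_i`. -/
abbrev VectorField (n : ℕ) : Type := Fin n → Germs (Fin n)

/-- The action of a vector field on germs. -/
def VectorField.apply {n : ℕ} (θ : VectorField n) (f : Germs (Fin n)) : Germs (Fin n) :=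
  ∑ i, θ i * partialDeriv i f

/-- The vector field on `ℂ_t × X` with the same coefficients as `θ`, as a differential operator. -/
def VectorField.lift {n : ℕ} (θ : VectorField n) : DiffOp (Option (Fin n)) :=
  ∑ i, ofGerm (pullback (θ i)) * del (some i)

/-- `h` is a reduced local equation of a divisor through the origin. -/
def IsReducedEquation {n : ℕ} (h : Germs (Fin n)) : Prop :=
  h ≠ 0 ∧ constantCoeff h.series = 0 ∧ (Ideal.span {h}).IsRadical

/-- The module `Θ(-log D)` of logarithmic vector fields along `D = {h = 0}`. -/
def logVectorFields {n : ℕ} (h : Germs (Fin n)) : Submodule (Germs (Fin n)) (VectorField n) where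
  carrier := {θ | θ.apply h ∈ Ideal.span {h}}
  add_mem' {θ η} hθ hη := by
    have : (θ + η).apply h = θ.apply h + η.apply h := by
      simp [VectorField.apply, add_mul, Finset.sum_add_distrib]
    simpa only [Set.mem_ofPred_eq, this] using add_mem hθ hη
  zero_mem' := by simp [VectorField.apply]
  smul_mem' a θ hθ := by
    have : (a • θ).apply h = a * θ.apply h := by
      simp [VectorField.apply, Finset.mul_sum, mul_assoc]
    simpa only [Set.mem_ofPred_eq, this] using Ideal.mul_mem_left _ a hθ

/-- `θ_1, …, θ_n` is a basis of the module of logarithmic vector fields. -/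
def IsLogBasis {n : ℕ} (h : Germs (Fin n)) (θ : Fin n → VectorField n) : Prop :=
  LinearIndependent (Germs (Fin n)) θ ∧
    Submodule.span (Germs (Fin n)) (Set.range θ) = logVectorFields h

/-- `D = {h = 0}` is a free divisor germ. -/
def IsFreeDivisor {n : ℕ} (h : Germs (Fin n)) : Prop :=
  IsReducedEquation h ∧ ∃ θ : Fin n → VectorField n, IsLogBasis h θ

/-- The graded ring of `𝒟_X[s]` for the total order filtration: the polynomial ring
`𝒪_X[σ(∂_1), …, σ(∂_n), s]`. The variable `some i` is `σ(∂_i)`, the variable `none` is `s`. -/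
abbrev TotalGraded (n : ℕ) : Type := MvPolynomial (Option (Fin n)) (Germs (Fin n))

/-- The symbol of a vector field. -/
def VectorField.symbol {n : ℕ} (θ : VectorField n) : TotalGraded n :=
  ∑ i, MvPolynomial.C (θ i) * MvPolynomial.X (some i)

/-- `D = {h = 0}` is a strongly Koszul free divisor germ: it is free, and for any basis
`δ_1, …, δ_n` of the logarithmic vector fields, with `δ_i(h) = α_i h`, the sequence
`h, σ(δ_1) - α_1 s, …, σ(δ_n) - α_n s` is regular. -/
def IsStronglyKoszulFree {n : ℕ} (h : Germs (Fin n)) : Prop :=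
  IsFreeDivisor h ∧
    ∀ (δ : Fin n → VectorField n) (α : Fin n → Germs (Fin n)),
      IsLogBasis h δ → (∀ i, (δ i).apply h = α i * h) →
      RingTheory.Sequence.IsRegular (TotalGraded n)
        (MvPolynomial.C h ::
          List.ofFn fun i => (δ i).symbol - MvPolynomial.C (α i) * MvPolynomial.X none)

/-! ### The module `N(h)` and its filtrations -/

/-- The left ideal `I(h)` of `𝒟_{ℂ_t × X,(0,p)}` generated by
`t - h, δ_1, …, δ_m, χ + ∂_t t + 1`. -/
def idealI {m : ℕ} (h : Germs (Fin (m + 1))) (δ : Fin m → VectorField (m + 1))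
    (χ : VectorField (m + 1)) :
    Submodule (DiffOp (Option (Fin (m + 1)))) (DiffOp (Option (Fin (m + 1)))) :=
  Submodule.span _
    ({ofGerm (coord none - pullback h)} ∪ Set.range (fun i => (δ i).lift) ∪
      {χ.lift + del none * ofGerm (coord none) + 1})

/-- The left module `N(h) = 𝒟 / I(h)`. -/
abbrev moduleN {m : ℕ} (h : Germs (Fin (m + 1))) (δ : Fin m → VectorField (m + 1))
    (χ : VectorField (m + 1)) : Type :=
  DiffOp (Option (Fin (m + 1))) ⧸ idealI h δ χ

/-- The projection `𝒟 → N(h)`, as a `ℂ`-linear map. -/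
def projN {m : ℕ} (h : Germs (Fin (m + 1))) (δ : Fin m → VectorField (m + 1))
    (χ : VectorField (m + 1)) :
    DiffOp (Option (Fin (m + 1))) →ₗ[ℂ] moduleN h δ χ :=
  (idealI h δ χ).mkQ.restrictScalars ℂ

/-- The order filtration `F^ord_l N(h)`, induced by `F_l 𝒟`. -/
def orderFiltrationN {m : ℕ} (h : Germs (Fin (m + 1))) (δ : Fin m → VectorField (m + 1))
    (χ : VectorField (m + 1)) (l : ℤ) : Submodule ℂ (moduleN h δ χ) :=
  (orderFiltration (Option (Fin (m + 1))) l).map (projN h δ χ)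

/-- The induced filtration `V^k_ind N(h)`, induced by `V^k 𝒟` (with respect to `{t = 0}`). -/
def vFiltrationN {m : ℕ} (h : Germs (Fin (m + 1))) (δ : Fin m → VectorField (m + 1))
    (χ : VectorField (m + 1)) (k : ℤ) : Submodule ℂ (moduleN h δ χ) :=
  (vFiltration (none : Option (Fin (m + 1))) k).map (projN h δ χ)

/-- The canonical morphism `F_l 𝒟 ∩ V^k 𝒟 → F^ord_l N(h) ∩ V^k_ind N(h)`. -/
def canonicalMap {m : ℕ} (h : Germs (Fin (m + 1))) (δ : Fin m → VectorField (m + 1))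
    (χ : VectorField (m + 1)) (k l : ℤ) :
    ↥(orderFiltration (Option (Fin (m + 1))) l ⊓ vFiltration (none : Option (Fin (m + 1))) k) →ₗ[ℂ]
      ↥(orderFiltrationN h δ χ l ⊓ vFiltrationN h δ χ k) :=
  (projN h δ χ).restrict fun _ hP =>
    ⟨Submodule.mem_map_of_mem hP.1, Submodule.mem_map_of_mem hP.2⟩

end SKFree

end

/-!
An element of `F^ord_l N(h) ∩ V^k_ind N(h)` is represented by some `P` of order at most `l` and by
some `Q ∈ V^k` with `P - Q ∈ I(h)`. The point is to lower the order of `Q` modulo `I(h)` without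
leaving `V^k`. This is possible because the generators of `I(h)` behave well with respect to both
filtrations at once.

*Reduction to polynomial coefficients in `t`.* Operators whose coefficients are polynomials in `t`
are determined by their normally ordered full symbols, which form the bigraded ring
`𝒪_X[σ(∂_x), σ(∂_t)][t]`; membership in `F_l` and `V^k` can be read off from the bidegrees
(`normalOp`, `bisupp`, `mem_weightGE_of_normalOp_mem`). Every operator is such an operator up to
`t^N` times an operator of the same order (`exists_truncation`), and operators of order `l`
multiplied by `t^N` lie in `V^{N-l}`, so for large `N` the remainders do not matter.

*The symbols of `I(h)`.* The strong Koszul hypothesis enters only through the fact that `h` is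
regular modulo the ideal `J` generated by `σ(δ_1), …, σ(δ_{n-1})` (`mem_span_symbol_of_C_mul_mem`,
since the first entry of a regular sequence stays regular modulo the later ones).
This has two consequences. First, since `h ξ_i ≡ (∂_i h) σ(χ)` modulo `J`, a homogeneous polynomial
that vanishes on the differentials `d(b h + c t)` lies in `J` (`mem_span_of_eval_eq_zero`; the
Jacobian ideal is of linear type). The `δ_i` commute with the functions `b h + c t`, and iterated
commutators with a function evaluate symbols at its differential, so the symbols of the left ideal
generated by the `δ_i` lie in `J` (`symbolsIn_fieldIdeal`). Second, `σ(χ) + t σ(∂_t)` is regular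
modulo `J` and `t - h` is regular modulo `J + (σ(χ) + t σ(∂_t))` (`mem_of_mul_eulerSymbol_mem`,
`mem_eulerIdeal_of_mul_graph_mem`). As the commutators of the generators are again combinations of
the generators, adjoining `χ + ∂_t t + 1` and `t - h` therefore only adjoins their symbols
(`SymbolsIn.sup_leftMultiples`, `symbolsIn_polyIdeal`): the symbols of the elements of `I(h)` lie
in the ideal generated by the symbols of the generators.

*Strictness.* The symbols of `δ_i` and `χ + ∂_t t + 1` are homogeneous of weight `0` for the
V-filtration, and `t - h` has initial form `-h`, which is regular modulo the other symbols. Hence a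
symbol of weight at least `k` in the ideal of symbols has cofactors of weight at least `k`
(`exists_bisupp_of_mem_graph`). If `Q ∈ V^k` has order bigger than `l`, its symbol is the symbol of
an element of `I(h)`, which can thus be chosen in `V^k`; subtracting it lowers the order
(`exists_normalOp_order_le`).
-/

noncomputable section

namespace SKFree

section Germs

open MvPowerSeries

/-! ### Germs of holomorphic functions -/

variable {σ : Type}

instance : IsDomain (Germs σ) :=
  haveI : IsDomain (MvPowerSeries σ ℂ) := NoZeroDivisors.to_isDomain _
  inferInstanceAs (IsDomain (convergentSeries σ))

theorem Germs.ext {f g : Germs σ} (h : f.series = g.series) : f = g := Subtype.ext h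

/-- The power series of a germ, as an algebra homomorphism. -/
def seriesHom (σ : Type) : Germs σ →ₐ[ℂ] MvPowerSeries σ ℂ := (convergentSeries σ).val

theorem series_add (f g : Germs σ) : (f + g).series = f.series + g.series :=
  map_add (seriesHom σ) f g

theorem series_mul (f g : Germs σ) : (f * g).series = f.series * g.series :=
  map_mul (seriesHom σ) f g

theorem series_algebraMap (c : ℂ) : (algebraMap ℂ (Germs σ) c).series = MvPowerSeries.C c := rfl

theorem series_coord (i : σ) : (coord i).series = X i := rfl

theorem series_partialDeriv (i : σ) (f : Germs σ) :
    (partialDeriv i f).series = pderiv ℂ i f.series := rfl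

theorem series_pullback (f : Germs σ) :
    (pullback f).series = rename (Function.Embedding.some : σ ↪ Option σ) f.series := rfl

theorem partialDeriv_mul (i : σ) (f g : Germs σ) :
    partialDeriv i (f * g) = f * partialDeriv i g + partialDeriv i f * g := by
  apply Germs.ext
  simp only [series_partialDeriv, series_mul, series_add, Derivation.leibniz, smul_eq_mul]
  ring

theorem partialDeriv_algebraMap (i : σ) (c : ℂ) :
    partialDeriv i (algebraMap ℂ (Germs σ) c) = 0 := by
  apply Germs.ext
  rw [series_partialDeriv, series_algebraMap, pderiv_C]
  rfl

theorem partialDeriv_one (i : σ) : partialDeriv i (1 : Germs σ) = 0 := by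
  simpa using partialDeriv_algebraMap i 1

theorem partialDeriv_coord [DecidableEq σ] (i j : σ) :
    partialDeriv i (coord j) = if i = j then 1 else 0 := by
  apply Germs.ext
  rw [series_partialDeriv, series_coord, pderiv_X]
  rcases eq_or_ne i j with rfl | hij
  · simp; rfl
  · simp [hij, Ne.symm hij]; rfl

theorem partialDeriv_comm (i j : σ) (f : Germs σ) :
    partialDeriv i (partialDeriv j f) = partialDeriv j (partialDeriv i f) := by
  classical
  apply Germs.ext
  ext a
  simp only [series_partialDeriv, coeff_pderiv, Finsupp.add_apply, Finsupp.single_apply]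
  rw [add_right_comm]
  rcases eq_or_ne i j with rfl | hij
  · rfl
  · simp [hij, Ne.symm hij]; ring

/-- Pull-back along the projection, as an algebra homomorphism. -/
def pullbackHom (σ : Type) : Germs σ →ₐ[ℂ] Germs (Option σ) where
  toFun := pullback
  map_one' := Germs.ext (map_one (rename (R := ℂ) (Function.Embedding.some : σ ↪ Option σ)))
  map_mul' _ _ := Germs.ext (map_mul (rename (Function.Embedding.some : σ ↪ Option σ)) _ _)
  map_zero' := Germs.ext (map_zero (rename (R := ℂ) (Function.Embedding.some : σ ↪ Option σ)))
  map_add' _ _ := Germs.ext (map_add (rename (Function.Embedding.some : σ ↪ Option σ)) _ _)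
  commutes' c := Germs.ext (AlgHom.commutes (rename (Function.Embedding.some : σ ↪ Option σ)) c)

theorem pullbackHom_apply (f : Germs σ) : pullbackHom σ f = pullback f := rfl

theorem coeff_pullback (f : Germs σ) (a : Option σ →₀ ℕ) :
    coeff a (pullback f).series = if a none = 0 then coeff a.some f.series else 0 := by
  classical
  rw [series_pullback]
  split_ifs with h
  · have : a = Finsupp.embDomain (Function.Embedding.some : σ ↪ Option σ) a.some := by
      ext i
      cases i with
      | none => rw [Finsupp.embDomain_of_notMem_range] <;> simp [h]
      | some i =>
        rw [show (some i : Option σ) = (Function.Embedding.some : σ ↪ Option σ) i from rfl,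
          Finsupp.embDomain_apply_self]
        simp
    conv_lhs => rw [this]
    rw [coeff_embDomain_rename]
  · apply coeff_rename_eq_zero
    rintro ⟨b, rfl⟩
    apply h
    rw [← Finsupp.embDomain_eq_mapDomain, Finsupp.embDomain_of_notMem_range]
    simp

theorem partialDeriv_none_pullback (f : Germs σ) : partialDeriv none (pullback f) = 0 := by
  apply Germs.ext
  ext a
  rw [series_partialDeriv, coeff_pderiv, coeff_pullback, if_neg (by simp), zero_mul]
  rfl

theorem partialDeriv_some_pullback (i : σ) (f : Germs σ) :
    partialDeriv (some i) (pullback f) = pullback (partialDeriv i f) := by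
  classical
  apply Germs.ext
  ext a
  rw [series_partialDeriv, coeff_pderiv, coeff_pullback, coeff_pullback, series_partialDeriv,
    coeff_pderiv]
  have h1 : (a + Finsupp.single (some i) 1 : Option σ →₀ ℕ) none = a none := by simp
  have h2 : (a + Finsupp.single (some i) 1 : Option σ →₀ ℕ).some =
      a.some + Finsupp.single i 1 := by simp
  rw [h1, h2]
  split_ifs <;> simp

theorem IsConvergent.exists_germ {u : MvPowerSeries σ ℂ} (hu : IsConvergent u) :
    ∃ f : Germs σ, f.series = u := ⟨⟨u, hu⟩, rfl⟩

/-- Restriction to the hyperplane `t = 0`. -/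
theorem exists_eq_pullback_add (f : Germs (Option σ)) :
    ∃ (f₀ : Germs σ) (q : Germs (Option σ)), f = pullback f₀ + coord none * q := by
  classical
  obtain ⟨r, hr, hf⟩ := f.isConvergent
  let e : σ ↪ Option σ := Function.Embedding.some
  let u : MvPowerSeries σ ℂ := fun a => coeff (Finsupp.embDomain e a) f.series
  let v : MvPowerSeries (Option σ) ℂ := fun a => coeff (a + Finsupp.single none 1) f.series
  have hu : ∀ a, coeff a u = coeff (Finsupp.embDomain e a) f.series := fun _ => rfl
  have hv : ∀ a, coeff a v = coeff (a + Finsupp.single none 1) f.series := fun _ => rfl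
  have hu' : IsConvergent u := by
    refine ⟨r, hr, (hf.comp_injective (Finsupp.embDomain_injective e)).congr fun a => ?_⟩
    rw [hu, Function.comp, Finsupp.embDomain_eq_mapDomain, Finsupp.degree_mapDomain]
  have hv' : IsConvergent v := by
    refine ⟨r, hr, ((hf.comp_injective
      (add_left_injective (Finsupp.single none 1))).mul_right r⁻¹).congr fun a => ?_⟩
    simp only [Function.comp, map_add, Finsupp.degree_single, pow_succ, hv]
    field_simp
  obtain ⟨f₀, hf₀⟩ := hu'.exists_germ
  obtain ⟨q, hq⟩ := hv'.exists_germ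
  refine ⟨f₀, q, Germs.ext ?_⟩
  ext a
  rw [series_add, series_mul, series_coord, map_add, coeff_pullback, hf₀, hq,
    X_mul, X, coeff_mul_monomial, hu, hv]
  split_ifs with h0 h1 h1
  · have := h1 none
    simp [h0] at this
  · rw [add_zero]
    congr 2
    ext i
    cases i with
    | none => rw [Finsupp.embDomain_of_notMem_range] <;> simp [h0, e]
    | some i =>
      rw [show (some i : Option σ) = e i from rfl, Finsupp.embDomain_apply_self]
      simp [e]
  · rw [zero_add, mul_one, tsub_add_cancel_of_le h1]
  · refine absurd ?_ h1
    rw [Finsupp.single_le_iff]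
    omega

theorem pullback_eq_zero_of_dvd {f : Germs σ} {g : Germs (Option σ)}
    (hfg : pullback f = coord none * g) : f = 0 := by
  classical
  apply Germs.ext
  ext a
  let e : σ ↪ Option σ := Function.Embedding.some
  have h := congrArg (fun u => coeff (Finsupp.embDomain e a) u.series) hfg
  have h0 : (Finsupp.embDomain e a) none = 0 := by
    rw [Finsupp.embDomain_of_notMem_range]; simp [e]
  have h1 : coeff (Finsupp.embDomain e a) (pullback f).series = coeff a f.series := by
    rw [series_pullback, coeff_embDomain_rename]
  simp only [series_mul, series_coord] at h
  rw [h1, X_mul, X, coeff_mul_monomial, if_neg] at h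
  · exact h
  · rw [Finsupp.single_le_iff, h0]
    omega

theorem pullback_injective : Function.Injective (pullback : Germs σ → Germs (Option σ)) := by
  refine (injective_iff_map_eq_zero (pullbackHom σ)).2 fun f hf => ?_
  exact pullback_eq_zero_of_dvd (g := 0) (by rw [mul_zero]; exact hf)

theorem coord_ne_zero (i : σ) : coord i ≠ 0 := fun h => by
  classical
  have := congrArg (partialDeriv i) h
  rw [partialDeriv_coord, if_pos rfl, map_zero] at this
  exact one_ne_zero this

/-- A polynomial in `t` that is divisible by `t ^ k` as a germ has no terms of degree below `k`. -/
theorem coeff_eq_zero_of_dvd_eval₂ (k : ℕ) :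
    ∀ (p : Polynomial (Germs σ)) (g : Germs (Option σ)),
      p.eval₂ (pullbackHom σ).toRingHom (coord none) = coord none ^ k * g →
      ∀ a < k, p.coeff a = 0 := by
  induction k with
  | zero => intro p g _ a ha; omega
  | succ k ih =>
    intro p g hpg
    have hp := p.divX_mul_X_add
    have h0 : p.coeff 0 = 0 := by
      apply pullback_eq_zero_of_dvd (g := coord none ^ k * g -
        p.divX.eval₂ (pullbackHom σ).toRingHom (coord none))
      rw [← hp, Polynomial.eval₂_add, Polynomial.eval₂_mul, Polynomial.eval₂_X,
        Polynomial.eval₂_C] at hpg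
      have h2 : (pullbackHom σ).toRingHom (p.coeff 0) = pullback (p.coeff 0) := rfl
      rw [h2] at hpg
      linear_combination hpg
    intro a ha
    cases a with
    | zero => exact h0
    | succ a =>
      rw [← Polynomial.coeff_divX]
      refine ih p.divX g ?_ a (by omega)
      apply mul_left_cancel₀ (coord_ne_zero (none : Option σ))
      rw [← hp, h0, map_zero, add_zero, Polynomial.eval₂_mul, Polynomial.eval₂_X] at hpg
      linear_combination hpg

end Germs

section Operators

/-! ### Differential operators and their filtrations -/

variable {σ : Type}

theorem act_ofGerm (f g : Germs σ) : (ofGerm f).act g = f * g := rfl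

theorem act_del (i : σ) (g : Germs σ) : (del i).act g = partialDeriv i g := rfl

theorem DiffOp.ext {P Q : DiffOp σ} (h : ∀ g, P.act g = Q.act g) : P = Q :=
  Subtype.ext (LinearMap.ext h)

theorem act_mul (P Q : DiffOp σ) (g : Germs σ) : (P * Q).act g = P.act (Q.act g) := by
  rw [map_mul]; rfl

/-- Germs as operators of order zero, as an algebra homomorphism. -/
def ofGermHom (σ : Type) : Germs σ →ₐ[ℂ] DiffOp σ where
  toFun := ofGerm
  map_one' := DiffOp.ext fun g => by rw [act_ofGerm, map_one, one_mul]; rfl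
  map_mul' f f' := DiffOp.ext fun g => by simp only [act_mul, act_ofGerm, mul_assoc]
  map_zero' := DiffOp.ext fun g => by rw [act_ofGerm, map_zero, zero_mul]; rfl
  map_add' f f' := DiffOp.ext fun g => by
    rw [map_add, LinearMap.add_apply]; simp only [act_ofGerm, add_mul]
  commutes' c := DiffOp.ext fun g => by
    rw [act_ofGerm, AlgHom.commutes, Module.algebraMap_end_apply, Algebra.smul_def]

theorem ofGerm_mul (f g : Germs σ) : ofGerm (f * g) = ofGerm f * ofGerm g :=
  map_mul (ofGermHom σ) f g

theorem ofGerm_add (f g : Germs σ) : ofGerm (f + g) = ofGerm f + ofGerm g :=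
  map_add (ofGermHom σ) f g

theorem ofGerm_sub (f g : Germs σ) : ofGerm (f - g) = ofGerm f - ofGerm g :=
  map_sub (ofGermHom σ) f g

theorem ofGerm_zero : ofGerm (0 : Germs σ) = 0 := map_zero (ofGermHom σ)

theorem ofGerm_one : ofGerm (1 : Germs σ) = 1 := map_one (ofGermHom σ)

theorem ofGerm_pow (f : Germs σ) (k : ℕ) : ofGerm (f ^ k) = ofGerm f ^ k :=
  map_pow (ofGermHom σ) f k

theorem ofGerm_commute (f g : Germs σ) : ofGerm f * ofGerm g = ofGerm g * ofGerm f := by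
  rw [← ofGerm_mul, mul_comm, ofGerm_mul]

theorem smul_eq_ofGerm_mul (c : ℂ) (P : DiffOp σ) :
    c • P = ofGerm (algebraMap ℂ (Germs σ) c) * P := by
  rw [Algebra.smul_def]
  congr 1
  exact (AlgHom.commutes (ofGermHom σ) c).symm

theorem del_mul_ofGerm (i : σ) (f : Germs σ) :
    del i * ofGerm f = ofGerm f * del i + ofGerm (partialDeriv i f) := DiffOp.ext fun g => by
  rw [map_add, LinearMap.add_apply]
  simp only [act_mul, act_ofGerm, act_del, partialDeriv_mul]

theorem del_commute (i j : σ) : Commute (del i) (del j) := DiffOp.ext fun g => by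
  simp only [act_mul, act_del]
  exact partialDeriv_comm i j g

/-! ### The order filtration -/

theorem orderFiltration_mono {l l' : ℤ} (h : l ≤ l') :
    orderFiltration σ l ≤ orderFiltration σ l' := by
  refine Submodule.span_mono ?_
  rintro _ ⟨f, L, hL, rfl⟩
  exact ⟨f, L, hL.trans h, rfl⟩

theorem mem_orderFiltration_of_length (f : Germs σ) (L : List σ) {l : ℤ} (hL : (L.length : ℤ) ≤ l) :
    ofGerm f * (L.map del).prod ∈ orderFiltration σ l :=
  Submodule.subset_span ⟨f, L, hL, rfl⟩

theorem ofGerm_mul_mem_orderFiltration (f : Germs σ) {l : ℤ} {P : DiffOp σ}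
    (hP : P ∈ orderFiltration σ l) : ofGerm f * P ∈ orderFiltration σ l := by
  induction hP using Submodule.span_induction with
  | mem P hP =>
    obtain ⟨g, L, hL, rfl⟩ := hP
    rw [← mul_assoc, ← ofGerm_mul]
    exact mem_orderFiltration_of_length _ _ hL
  | zero => rw [mul_zero]; exact zero_mem _
  | add P Q _ _ hP hQ => rw [mul_add]; exact add_mem hP hQ
  | smul c P _ hP => rw [mul_smul_comm]; exact Submodule.smul_mem _ c hP

theorem del_mul_mem_orderFiltration (i : σ) {l : ℤ} {P : DiffOp σ}
    (hP : P ∈ orderFiltration σ l) : del i * P ∈ orderFiltration σ (l + 1) := by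
  induction hP using Submodule.span_induction with
  | mem P hP =>
    obtain ⟨g, L, hL, rfl⟩ := hP
    rw [← mul_assoc, del_mul_ofGerm, add_mul, mul_assoc]
    refine add_mem ?_ (mem_orderFiltration_of_length _ _ (by omega))
    have := mem_orderFiltration_of_length g (i :: L) (l := l + 1) (by simpa using hL)
    simpa using this
  | zero => rw [mul_zero]; exact zero_mem _
  | add P Q _ _ hP hQ => rw [mul_add]; exact add_mem hP hQ
  | smul c P _ hP => rw [mul_smul_comm]; exact Submodule.smul_mem _ c hP

theorem mul_mem_orderFiltration {l l' : ℤ} {P Q : DiffOp σ} (hP : P ∈ orderFiltration σ l)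
    (hQ : Q ∈ orderFiltration σ l') : P * Q ∈ orderFiltration σ (l + l') := by
  induction hP using Submodule.span_induction with
  | mem P hP =>
    obtain ⟨g, L, hL, rfl⟩ := hP
    rw [mul_assoc]
    apply ofGerm_mul_mem_orderFiltration
    apply orderFiltration_mono (add_le_add_left hL l')
    clear hL
    induction L with
    | nil => simpa using hQ
    | cons i L ih =>
      rw [List.map_cons, List.prod_cons, mul_assoc]
      have := del_mul_mem_orderFiltration i ih
      refine orderFiltration_mono ?_ this
      push_cast [List.length_cons]
      omega
  | zero => rw [zero_mul]; exact zero_mem _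
  | add P P' _ _ hP hP' => rw [add_mul]; exact add_mem hP hP'
  | smul c P _ hP => rw [smul_mul_assoc]; exact Submodule.smul_mem _ c hP

theorem ofGerm_mem_orderFiltration (f : Germs σ) {l : ℤ} (hl : 0 ≤ l) :
    ofGerm f ∈ orderFiltration σ l := by
  simpa using mem_orderFiltration_of_length f [] (l := l) (by simpa using hl)

theorem del_mem_orderFiltration (i : σ) : del i ∈ orderFiltration σ 1 := by
  simpa [ofGerm_one] using mem_orderFiltration_of_length 1 [i] (l := 1) (by simp)

theorem exists_mem_orderFiltration (P : DiffOp σ) : ∃ l : ℕ, P ∈ orderFiltration σ l := by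
  obtain ⟨P, hP⟩ := P
  induction hP using Algebra.adjoin_induction with
  | mem P hP =>
    rcases hP with ⟨f, rfl⟩ | ⟨i, rfl⟩
    · exact ⟨0, ofGerm_mem_orderFiltration f le_rfl⟩
    · exact ⟨1, del_mem_orderFiltration i⟩
  | algebraMap c =>
    refine ⟨0, ?_⟩
    have := ofGerm_mem_orderFiltration (algebraMap ℂ (Germs σ) c) (l := (0 : ℕ)) le_rfl
    rwa [show ofGerm (algebraMap ℂ (Germs σ) c) = algebraMap ℂ (DiffOp σ) c from
      AlgHom.commutes (ofGermHom σ) c] at this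
  | add P Q hP' hQ' hP hQ =>
    obtain ⟨l, hl⟩ := hP
    obtain ⟨l', hl'⟩ := hQ
    exact ⟨max l l', add_mem (orderFiltration_mono (by simp) hl)
      (orderFiltration_mono (by simp) hl')⟩
  | mul P Q hP' hQ' hP hQ =>
    obtain ⟨l, hl⟩ := hP
    obtain ⟨l', hl'⟩ := hQ
    exact ⟨l + l', by push_cast; exact mul_mem_orderFiltration hl hl'⟩

/-! ### The V-filtration -/

theorem mem_divisorIdealPow {c : σ} {i : ℤ} {f : Germs σ} :
    f ∈ divisorIdealPow c i ↔ ∃ g, f = coord c ^ i.toNat * g := by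
  rw [divisorIdealPow, Ideal.span_singleton_pow, Ideal.mem_span_singleton]
  rfl

theorem divisorIdealPow_anti (c : σ) {i j : ℤ} (h : i ≤ j) :
    divisorIdealPow c j ≤ divisorIdealPow c i :=
  Ideal.pow_le_pow_right (by omega)

theorem vFiltration_anti (c : σ) {k k' : ℤ} (h : k ≤ k') :
    vFiltration c k' ≤ vFiltration c k := fun _ hP i f hf =>
  divisorIdealPow_anti c (by omega) (hP i f hf)

theorem mul_mem_vFiltration {c : σ} {k k' : ℤ} {P Q : DiffOp σ} (hP : P ∈ vFiltration c k)
    (hQ : Q ∈ vFiltration c k') : P * Q ∈ vFiltration c (k + k') := fun i f hf => by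
  rw [act_mul, show i + (k + k') = i + k' + k by ring]
  exact hP _ _ (hQ i f hf)

theorem ofGerm_mem_vFiltration (c : σ) (f : Germs σ) : ofGerm f ∈ vFiltration c 0 :=
  fun i g hg => by
  rw [act_ofGerm, add_zero]
  exact Ideal.mul_mem_left _ f hg

theorem coord_mem_vFiltration (c : σ) : ofGerm (coord c) ∈ vFiltration c 1 := fun i f hf => by
  obtain ⟨g, rfl⟩ := mem_divisorIdealPow.1 hf
  rw [act_ofGerm]
  refine divisorIdealPow_anti c (j := (i.toNat + 1 : ℕ)) (by omega) (mem_divisorIdealPow.2 ⟨g, ?_⟩)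
  rw [Int.toNat_natCast]
  ring

theorem coord_pow_mem_vFiltration (c : σ) (N : ℕ) :
    ofGerm (coord c) ^ N ∈ vFiltration c N := by
  induction N with
  | zero => simpa [ofGerm_one] using ofGerm_mem_vFiltration c 1
  | succ N ih =>
    rw [pow_succ]
    push_cast
    exact mul_mem_vFiltration ih (coord_mem_vFiltration c)

theorem partialDeriv_coord_pow_of_ne {i c : σ} (h : i ≠ c) (k : ℕ) :
    partialDeriv i (coord c ^ k) = 0 := by
  classical
  induction k with
  | zero => rw [pow_zero, partialDeriv_one]
  | succ k ih => rw [pow_succ, partialDeriv_mul, ih, partialDeriv_coord, if_neg h]; ring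

theorem partialDeriv_coord_pow (c : σ) (k : ℕ) :
    partialDeriv c (coord c ^ (k + 1)) = (k + 1 : ℕ) * coord c ^ k := by
  classical
  induction k with
  | zero => rw [zero_add, pow_one, partialDeriv_coord, if_pos rfl]; simp
  | succ k ih =>
    rw [pow_succ, partialDeriv_mul, ih, partialDeriv_coord, if_pos rfl]; push_cast; ring

theorem del_mem_vFiltration_of_ne {i c : σ} (h : i ≠ c) : del i ∈ vFiltration c 0 :=
  fun j f hf => by
  obtain ⟨g, rfl⟩ := mem_divisorIdealPow.1 hf
  rw [act_del, add_zero, partialDeriv_mul, partialDeriv_coord_pow_of_ne h, zero_mul, add_zero]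
  exact mem_divisorIdealPow.2 ⟨_, rfl⟩

theorem del_mem_vFiltration (c : σ) : del c ∈ vFiltration c (-1) := fun j f hf => by
  obtain ⟨g, rfl⟩ := mem_divisorIdealPow.1 hf
  rw [act_del, partialDeriv_mul]
  rcases le_or_gt j 0 with hj | hj
  · rw [mem_divisorIdealPow]
    exact ⟨_, by rw [Int.toNat_of_nonpos (by omega : j + -1 ≤ 0), pow_zero, one_mul]⟩
  · obtain ⟨k, rfl⟩ : ∃ k : ℕ, j = (k + 1 : ℕ) := ⟨(j - 1).toNat, by omega⟩
    rw [Int.toNat_natCast, partialDeriv_coord_pow]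
    refine mem_divisorIdealPow.2 ⟨coord c * partialDeriv c g + (k + 1 : ℕ) * g, ?_⟩
    rw [show ((k + 1 : ℕ) + -1 : ℤ).toNat = k by omega]
    ring

theorem one_mem_vFiltration (c : σ) : (1 : DiffOp σ) ∈ vFiltration c 0 := by
  simpa [ofGerm_one] using ofGerm_mem_vFiltration c 1

theorem orderFiltration_le_vFiltration (c : σ) (l : ℤ) :
    orderFiltration σ l ≤ vFiltration c (-l) := by
  refine Submodule.span_le.2 ?_
  rintro _ ⟨f, L, hL, rfl⟩
  have key : (L.map del).prod ∈ vFiltration c (-L.length : ℤ) := by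
    clear hL
    induction L with
    | nil => simpa using one_mem_vFiltration c
    | cons i L ih =>
      rw [List.map_cons, List.prod_cons]
      have hi : del i ∈ vFiltration c (-1) := by
        rcases eq_or_ne i c with rfl | h
        · exact del_mem_vFiltration i
        · exact vFiltration_anti c (by omega) (del_mem_vFiltration_of_ne h)
      refine vFiltration_anti c ?_ (mul_mem_vFiltration hi ih)
      push_cast [List.length_cons]
      omega
  exact vFiltration_anti c (by omega) (mul_mem_vFiltration (ofGerm_mem_vFiltration c f) key)

/-! ### Commutators with germs -/

/-- The commutator `P ↦ P γ - γ P` with a germ `γ`. -/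
def adGerm (γ : Germs σ) : DiffOp σ →ₗ[ℂ] DiffOp σ :=
  LinearMap.mulRight ℂ (ofGerm γ) - LinearMap.mulLeft ℂ (ofGerm γ)

theorem adGerm_apply (γ : Germs σ) (P : DiffOp σ) :
    adGerm γ P = P * ofGerm γ - ofGerm γ * P := rfl

theorem adGerm_mul (γ : Germs σ) (P Q : DiffOp σ) :
    adGerm γ (P * Q) = P * adGerm γ Q + adGerm γ P * Q := by
  simp only [adGerm_apply]
  noncomm_ring

theorem adGerm_ofGerm (γ f : Germs σ) : adGerm γ (ofGerm f) = 0 := by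
  rw [adGerm_apply, ofGerm_commute, sub_self]

theorem adGerm_del (γ : Germs σ) (i : σ) : adGerm γ (del i) = ofGerm (partialDeriv i γ) := by
  rw [adGerm_apply, del_mul_ofGerm, add_sub_cancel_left]

theorem adGerm_ofGerm_mul (γ f : Germs σ) (P : DiffOp σ) :
    adGerm γ (ofGerm f * P) = ofGerm f * adGerm γ P := by
  rw [adGerm_mul, adGerm_ofGerm, zero_mul, add_zero]

theorem adGerm_iterate_ofGerm_mul (γ f : Germs σ) (P : DiffOp σ) (l : ℕ) :
    (adGerm γ ^ l) (ofGerm f * P) = ofGerm f * (adGerm γ ^ l) P := by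
  induction l with
  | zero => rfl
  | succ l ih => rw [pow_succ', Module.End.mul_apply, ih, adGerm_ofGerm_mul]; rfl

theorem adGerm_iterate_del_mul (γ : Germs σ) (i : σ) (P : DiffOp σ) (l : ℕ) :
    (adGerm γ ^ (l + 1)) (del i * P) = del i * (adGerm γ ^ (l + 1)) P +
      (l + 1) • (ofGerm (partialDeriv i γ) * (adGerm γ ^ l) P) := by
  induction l with
  | zero => simp [adGerm_mul, adGerm_del]
  | succ l ih =>
    have hs (n : ℕ) (Q : DiffOp σ) : (adGerm γ ^ (n + 1)) Q = adGerm γ ((adGerm γ ^ n) Q) := by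
      rw [pow_succ', Module.End.mul_apply]
    rw [hs (l + 1) (del i * P), ih, map_add, map_nsmul, adGerm_mul, adGerm_del, adGerm_ofGerm_mul,
      ← hs, ← hs, succ_nsmul _ (l + 1)]
    abel

theorem adGerm_iterate_list_of_lt (γ : Germs σ) (L : List σ) (l : ℕ) (hl : L.length < l) :
    (adGerm γ ^ l) (L.map del).prod = 0 := by
  induction L generalizing l with
  | nil =>
    obtain ⟨l, rfl⟩ := Nat.exists_eq_succ_of_ne_zero (by simpa using hl.ne')
    rw [List.map_nil, List.prod_nil, ← ofGerm_one, pow_succ, Module.End.mul_apply, adGerm_ofGerm,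
      map_zero]
  | cons i L ih =>
    obtain ⟨l, rfl⟩ := Nat.exists_eq_succ_of_ne_zero (by omega : l ≠ 0)
    rw [List.length_cons] at hl
    rw [List.map_cons, List.prod_cons, adGerm_iterate_del_mul, ih _ (by omega), ih _ (by omega)]
    simp

theorem adGerm_iterate_eq_zero (γ : Germs σ) (l : ℕ) {P : DiffOp σ}
    (hP : P ∈ orderFiltration σ (l - 1)) : (adGerm γ ^ l) P = 0 := by
  induction hP using Submodule.span_induction with
  | mem P hP =>
    obtain ⟨g, L, hL, rfl⟩ := hP
    rw [adGerm_iterate_ofGerm_mul, adGerm_iterate_list_of_lt _ _ _ (by omega), mul_zero]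
  | zero => rw [map_zero]
  | add P Q _ _ hP hQ => rw [map_add, hP, hQ, add_zero]
  | smul c P _ hP => rw [map_smul, hP, smul_zero]

theorem adGerm_mem_vFiltration {c : σ} {k j : ℤ} {P : DiffOp σ} (hP : P ∈ vFiltration c k)
    {γ : Germs σ} (hγ : ofGerm γ ∈ vFiltration c j) : adGerm γ P ∈ vFiltration c (k + j) :=
  sub_mem (mul_mem_vFiltration hP hγ) (add_comm j k ▸ mul_mem_vFiltration hγ hP)

/-! ### Normally ordered operators with coefficients polynomial in `t` -/

/-- The symbol ring `𝒪_X[σ(∂_x), σ(∂_t)][t]` of the operators on `ℂ_t × X` whose coefficients are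
polynomials in `t`. The inner variables are `none ↔ σ(∂_t)` and `some i ↔ σ(∂_{x_i})`; the outer
variable is `t`. -/
abbrev SymbolRing (σ : Type) : Type := Polynomial (MvPolynomial (Option σ) (Germs σ))

/-- The operator `∂^α`. -/
def dpow {κ : Type} (α : κ →₀ ℕ) : DiffOp κ := ((Finsupp.toMultiset α).toList.map del).prod

theorem list_prod_del {κ : Type} {L : List κ} {α : κ →₀ ℕ} (h : (L : Multiset κ) = α.toMultiset) :
    (L.map del).prod = dpow α := by
  rw [dpow]
  refine List.Perm.prod_eq' (List.Perm.map _ (Multiset.coe_eq_coe.1 ?_)) ?_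
  · rw [h, Multiset.coe_toList]
  · exact List.pairwise_map.2 (List.pairwise_of_forall fun i j => del_commute i j)

theorem dpow_zero {κ : Type} : dpow (0 : κ →₀ ℕ) = 1 :=
  (list_prod_del (L := []) (by simp)).symm

theorem dpow_add {κ : Type} (α β : κ →₀ ℕ) : dpow (α + β) = dpow α * dpow β := by
  symm
  rw [dpow, dpow, ← List.prod_append, ← List.map_append]
  refine list_prod_del ?_
  rw [← Multiset.coe_add, Multiset.coe_toList, Multiset.coe_toList, map_add]

theorem dpow_single {κ : Type} (i : κ) : dpow (Finsupp.single i 1) = del i := by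
  rw [← list_prod_del (L := [i])]
  · simp
  · simp

theorem length_toList_toMultiset {κ : Type} (α : κ →₀ ℕ) :
    (Finsupp.toMultiset α).toList.length = α.degree := by
  rw [Multiset.length_toList, Finsupp.card_toMultiset]
  rfl

theorem del_mul_dpow {κ : Type} (i : κ) (α : κ →₀ ℕ) :
    del i * dpow α = dpow (α + Finsupp.single i 1) := by
  rw [add_comm, dpow_add, dpow_single]

theorem dpow_mem_orderFiltration {κ : Type} (α : κ →₀ ℕ) :
    dpow α ∈ orderFiltration κ α.degree := by
  have := mem_orderFiltration_of_length 1 (Finsupp.toMultiset α).toList (l := α.degree)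
    (by rw [length_toList_toMultiset])
  rwa [ofGerm_one, one_mul] at this

/-- The normally ordered operator `∑ f_α ∂^α` with symbol `∑ f_α ξ^α`, whose coefficients do not
depend on `t`. -/
def normalOp₀ (σ : Type) : MvPolynomial (Option σ) (Germs σ) →+ DiffOp (Option σ) :=
  AddMonoidAlgebra.liftNC
    (((ofGermHom (Option σ)).comp (pullbackHom σ) : Germs σ →ₐ[ℂ] DiffOp (Option σ)) :
      Germs σ →+ DiffOp (Option σ))
    (fun α => dpow α.toAdd)

theorem normalOp₀_monomial (α : Option σ →₀ ℕ) (f : Germs σ) :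
    normalOp₀ σ (MvPolynomial.monomial α f) = ofGerm (pullback f) * dpow α :=
  AddMonoidAlgebra.liftNC_single _ _ _ _

/-- The normally ordered operator `∑ t^a f_{a,α} ∂^α` with full symbol `∑ t^a f_{a,α} ξ^α`. -/
def normalOp (σ : Type) : SymbolRing σ →+ DiffOp (Option σ) where
  toFun q := q.sum fun a p => ofGerm (coord none) ^ a * normalOp₀ σ p
  map_zero' := Polynomial.sum_zero_index _
  map_add' q q' := Polynomial.sum_add_index _ _ _ (fun _ => by rw [map_zero, mul_zero])
    (fun _ _ _ => by rw [map_add, mul_add])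

theorem normalOp_monomial (a : ℕ) (p : MvPolynomial (Option σ) (Germs σ)) :
    normalOp σ (Polynomial.monomial a p) = ofGerm (coord none) ^ a * normalOp₀ σ p :=
  Polynomial.sum_monomial_index (n := a) p (fun a p => ofGerm (coord none) ^ a * normalOp₀ σ p)
    (by rw [map_zero, mul_zero])

/-- The element `t^a f ξ^α` of the symbol ring. -/
def term (a : ℕ) (α : Option σ →₀ ℕ) (f : Germs σ) : SymbolRing σ :=
  Polynomial.monomial a (MvPolynomial.monomial α f)

theorem term_mul_term (a b : ℕ) (α β : Option σ →₀ ℕ) (f g : Germs σ) :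
    term a α f * term b β g = term (a + b) (α + β) (f * g) := by
  simp [term, Polynomial.monomial_mul_monomial, MvPolynomial.monomial_mul]

theorem coeff_term [DecidableEq σ] (a b : ℕ) (α β : Option σ →₀ ℕ) (f : Germs σ) :
    MvPolynomial.coeff β ((term a α f).coeff b) = if a = b ∧ α = β then f else 0 := by
  rw [term, Polynomial.coeff_monomial]
  split_ifs with h1 h2 h2
  · rw [MvPolynomial.coeff_monomial, if_pos h2.2]
  · rw [MvPolynomial.coeff_monomial, if_neg (fun h => h2 ⟨h1, h⟩)]
  · exact absurd h2.1 h1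
  · rw [MvPolynomial.coeff_zero]

theorem normalOp_term (a : ℕ) (α : Option σ →₀ ℕ) (f : Germs σ) :
    normalOp σ (term a α f) = ofGerm (coord none ^ a * pullback f) * dpow α := by
  rw [term, normalOp_monomial, normalOp₀_monomial, ofGerm_mul, ofGerm_pow, mul_assoc]

theorem eq_sum_term (q : SymbolRing σ) :
    q = ∑ a ∈ q.support, ∑ α ∈ (q.coeff a).support,
      term a α (MvPolynomial.coeff α (q.coeff a)) := by
  conv_lhs => rw [q.as_sum_support]
  refine Finset.sum_congr rfl fun a _ => ?_
  conv_lhs => rw [MvPolynomial.as_sum (q.coeff a), map_sum]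
  rfl

/-- The bidegree of `t^a ξ^α`: its weight for the V-filtration and its order. -/
def bidegree (a : ℕ) (α : Option σ →₀ ℕ) : ℤ × ℤ := (a - α none, α.degree)

/-- The symbols all of whose terms have bidegree in `S`. -/
def bisupp (σ : Type) (S : Set (ℤ × ℤ)) : AddSubgroup (SymbolRing σ) where
  carrier := {q | ∀ a α, MvPolynomial.coeff α (q.coeff a) ≠ 0 → bidegree a α ∈ S}
  zero_mem' a α h := by simp at h
  add_mem' {p q} hp hq a α h := by
    by_cases hpa : MvPolynomial.coeff α (p.coeff a) = 0
    · refine hq a α fun hqa => h ?_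
      rw [Polynomial.coeff_add, MvPolynomial.coeff_add, hpa, hqa, add_zero]
    · exact hp a α hpa
  neg_mem' {p} hp a α h := by
    refine hp a α fun hpa => h ?_
    rw [Polynomial.coeff_neg, MvPolynomial.coeff_neg, hpa, neg_zero]

theorem bisupp_mono {S T : Set (ℤ × ℤ)} (h : S ⊆ T) : bisupp σ S ≤ bisupp σ T :=
  fun _ hq a α h' => h (hq a α h')

theorem term_mem_bisupp {S : Set (ℤ × ℤ)} {a : ℕ} {α : Option σ →₀ ℕ} (f : Germs σ)
    (h : bidegree a α ∈ S) : term a α f ∈ bisupp σ S := fun b β hb => by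
  classical
  rw [coeff_term] at hb
  split_ifs at hb with h'
  · rw [← h'.1, ← h'.2]; exact h
  · exact absurd rfl hb

theorem bisupp_induction {S : Set (ℤ × ℤ)} {motive : ∀ q, q ∈ bisupp σ S → Prop}
    (zero : motive 0 (zero_mem _))
    (add : ∀ p q hp hq, motive p hp → motive q hq → motive (p + q) (add_mem hp hq))
    (term : ∀ a α f (h : bidegree a α ∈ S), motive (term a α f) (term_mem_bisupp f h))
    {q : SymbolRing σ} (hq : q ∈ bisupp σ S) : motive q hq := by
  suffices ∃ h, motive q h from this.2
  have hadd : ∀ p q, (∃ h, motive p h) → (∃ h, motive q h) → ∃ h, motive (p + q) h :=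
    fun p q ⟨hp, hp'⟩ ⟨hq, hq'⟩ => ⟨_, add p q hp hq hp' hq'⟩
  rw [eq_sum_term q]
  refine Finset.sum_induction _ (fun q => ∃ h, motive q h) hadd ⟨_, zero⟩ fun a _ => ?_
  refine Finset.sum_induction _ (fun q => ∃ h, motive q h) hadd ⟨_, zero⟩ fun α hα => ?_
  exact ⟨_, term a α _ (hq a α (MvPolynomial.mem_support_iff.1 hα))⟩

theorem symbolRing_induction {motive : SymbolRing σ → Prop} (zero : motive 0)
    (add : ∀ p q, motive p → motive q → motive (p + q))
    (term : ∀ a α f, motive (term a α f)) (q : SymbolRing σ) : motive q :=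
  bisupp_induction (S := Set.univ) (motive := fun q _ => motive q) zero
    (fun p q _ _ => add p q) (fun a α f _ => term a α f) (fun _ _ _ => trivial)

theorem finsupp_nat_induction {κ : Type} {motive : (κ →₀ ℕ) → Prop} (zero : motive 0)
    (add_single : ∀ α i, motive α → motive (α + Finsupp.single i 1)) (α : κ →₀ ℕ) : motive α := by
  classical
  induction hn : α.degree generalizing α with
  | zero => rw [(Finsupp.degree_eq_zero_iff α).1 hn]; exact zero
  | succ n ih =>
    obtain ⟨i, hi⟩ : ∃ i, α i ≠ 0 := by
      by_contra! h
      rw [show α = 0 from Finsupp.ext h] at hn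
      simp at hn
    have hα : α - Finsupp.single i 1 + Finsupp.single i 1 = α :=
      tsub_add_cancel_of_le (Finsupp.single_le_iff.2 (by omega))
    rw [← hα]
    refine add_single _ i (ih _ ?_)
    rw [← hα, map_add, Finsupp.degree_single] at hn
    omega

theorem bidegree_add (a b : ℕ) (α β : Option σ →₀ ℕ) :
    bidegree (a + b) (α + β) = bidegree a α + bidegree b β := by
  simp only [bidegree, map_add, Finsupp.add_apply, Prod.mk_add_mk]
  push_cast
  congr 1
  ring

theorem mul_mem_bisupp {S T U : Set (ℤ × ℤ)} {p q : SymbolRing σ} (hp : p ∈ bisupp σ S)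
    (hq : q ∈ bisupp σ T) (h : ∀ s ∈ S, ∀ t ∈ T, s + t ∈ U) : p * q ∈ bisupp σ U := by
  induction hp using bisupp_induction with
  | zero => rw [zero_mul]; exact zero_mem _
  | add p p' _ _ hp hp' => rw [add_mul]; exact add_mem hp hp'
  | term a α f ha =>
    induction hq using bisupp_induction with
    | zero => rw [mul_zero]; exact zero_mem _
    | add p p' _ _ hp hp' => rw [mul_add]; exact add_mem hp hp'
    | term b β g hb =>
      rw [term_mul_term]
      exact term_mem_bisupp _ (by rw [bidegree_add]; exact h _ ha _ hb)

/-- The symbols of order at most `l`. -/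
abbrev ordLE (σ : Type) (l : ℤ) : AddSubgroup (SymbolRing σ) := bisupp σ {s | s.2 ≤ l}

/-- The symbols that are homogeneous of order `l`. -/
abbrev homog (σ : Type) (l : ℤ) : AddSubgroup (SymbolRing σ) := bisupp σ {s | s.2 = l}

/-- The symbols of weight at least `k` for the V-filtration. -/
abbrev weightGE (σ : Type) (k : ℤ) : AddSubgroup (SymbolRing σ) := bisupp σ {s | k ≤ s.1}

theorem homog_le_ordLE (l : ℤ) : homog σ l ≤ ordLE σ l :=
  bisupp_mono fun _ hs => le_of_eq hs

theorem ordLE_mono {l l' : ℤ} (h : l ≤ l') : ordLE σ l ≤ ordLE σ l' :=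
  bisupp_mono fun _ hs => le_trans hs h

theorem ordLE_of_neg {l : ℤ} (hl : l < 0) {q : SymbolRing σ} (hq : q ∈ ordLE σ l) : q = 0 := by
  induction hq using bisupp_induction with
  | zero => rfl
  | add p q _ _ hp hq => rw [hp, hq, add_zero]
  | term a α f h =>
    have : ((α.degree : ℕ) : ℤ) ≤ l := h
    omega

theorem exists_mem_ordLE (q : SymbolRing σ) : ∃ d : ℕ, q ∈ ordLE σ d := by
  induction q using symbolRing_induction with
  | zero => exact ⟨0, zero_mem _⟩
  | add p q hp hq =>
    obtain ⟨d, hd⟩ := hp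
    obtain ⟨e, he⟩ := hq
    exact ⟨max d e, add_mem (ordLE_mono (by simp) hd) (ordLE_mono (by simp) he)⟩
  | term a α f => exact ⟨α.degree, term_mem_bisupp f (le_refl (α.degree : ℤ))⟩

theorem normalOp_mem_orderFiltration {l : ℤ} {q : SymbolRing σ} (hq : q ∈ ordLE σ l) :
    normalOp σ q ∈ orderFiltration (Option σ) l := by
  induction hq using bisupp_induction with
  | zero => rw [map_zero]; exact zero_mem _
  | add p q _ _ hp hq => rw [map_add]; exact add_mem hp hq
  | term a α f h =>
    rw [normalOp_term]
    exact orderFiltration_mono h (ofGerm_mul_mem_orderFiltration _ (dpow_mem_orderFiltration α))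

/-! ### Products of normally ordered operators -/

theorem normalOp_germ_mul (a : ℕ) (f : Germs σ) (q : SymbolRing σ) :
    normalOp σ (term a 0 f * q) = ofGerm (coord none ^ a * pullback f) * normalOp σ q := by
  induction q using symbolRing_induction with
  | zero => simp
  | add p q hp hq => rw [mul_add, map_add, map_add, mul_add, hp, hq]
  | term b β g =>
    rw [term_mul_term, normalOp_term, normalOp_term, ← mul_assoc, ← ofGerm_mul, zero_add]
    congr 2
    rw [show pullback (f * g) = pullback f * pullback g from map_mul (pullbackHom σ) f g]
    ring

theorem exists_partialDeriv_coeff (i : Option σ) (a : ℕ) (f : Germs σ) :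
    ∃ (b : ℕ) (g : Germs σ), partialDeriv i (coord none ^ a * pullback f) =
      coord none ^ b * pullback g := by
  rw [partialDeriv_mul]
  cases i with
  | some i =>
    refine ⟨a, partialDeriv i f, ?_⟩
    rw [partialDeriv_some_pullback, partialDeriv_coord_pow_of_ne (by simp), zero_mul, add_zero]
  | none =>
    rw [partialDeriv_none_pullback, mul_zero, zero_add]
    cases a with
    | zero => exact ⟨0, 0, by
        rw [pow_zero, partialDeriv_one, zero_mul, one_mul]
        exact (map_zero (pullbackHom σ)).symm⟩
    | succ a =>
      refine ⟨a, (a + 1 : ℕ) * f, ?_⟩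
      rw [partialDeriv_coord_pow, ← pullbackHom_apply, ← pullbackHom_apply, map_mul, map_natCast]
      ring

theorem exists_del_mul_normalOp (i : Option σ) {d : ℤ} {q : SymbolRing σ} (hq : q ∈ ordLE σ d) :
    ∃ r ∈ ordLE σ d,
      del i * normalOp σ q = normalOp σ (Polynomial.C (MvPolynomial.X i) * q + r) := by
  induction hq using bisupp_induction with
  | zero => exact ⟨0, zero_mem _, by simp⟩
  | add p q _ _ hp hq =>
    obtain ⟨r, hr, hp⟩ := hp
    obtain ⟨s, hs, hq⟩ := hq
    refine ⟨r + s, add_mem hr hs, ?_⟩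
    rw [map_add, mul_add, hp, hq, ← map_add]
    congr 1
    ring
  | term a α f h =>
    obtain ⟨b, g, hbg⟩ := exists_partialDeriv_coeff i a f
    refine ⟨term b α g, term_mem_bisupp g h, ?_⟩
    have hX : (Polynomial.C (MvPolynomial.X i) : SymbolRing σ) =
        term 0 (Finsupp.single i 1) 1 := rfl
    rw [hX, term_mul_term, map_add, normalOp_term, normalOp_term, normalOp_term, ← mul_assoc,
      del_mul_ofGerm, hbg, add_mul, mul_assoc, del_mul_dpow, zero_add, one_mul, add_comm α]

theorem exists_dpow_mul_normalOp (α : Option σ →₀ ℕ) {d : ℤ} {q : SymbolRing σ}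
    (hq : q ∈ ordLE σ d) :
    ∃ r ∈ ordLE σ (α.degree + d - 1),
      dpow α * normalOp σ q = normalOp σ (term 0 α 1 * q + r) := by
  induction α using finsupp_nat_induction with
  | zero =>
    refine ⟨0, zero_mem _, ?_⟩
    rw [dpow_zero, one_mul, add_zero]
    congr 1
    exact (one_mul q).symm
  | add_single α i ih =>
    obtain ⟨r, hr, ih⟩ := ih
    have hα : term 0 α 1 * q + r ∈ ordLE σ (α.degree + d) := by
      refine add_mem (mul_mem_bisupp
        (term_mem_bisupp (S := {s | s.2 ≤ α.degree}) 1 (le_refl (α.degree : ℤ))) hq ?_)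
        (ordLE_mono (by omega) hr)
      exact fun s (hs : s.2 ≤ _) t (ht : t.2 ≤ _) => (add_le_add hs ht : s.2 + t.2 ≤ _)
    obtain ⟨r', hr', ih'⟩ := exists_del_mul_normalOp i hα
    refine ⟨Polynomial.C (MvPolynomial.X i) * r + r', ?_, ?_⟩
    · have hX : (Polynomial.C (MvPolynomial.X i) : SymbolRing σ) ∈ ordLE σ 1 :=
        term_mem_bisupp (a := 0) (α := Finsupp.single i 1) 1 (by simp [bidegree])
      rw [map_add, Finsupp.degree_single]
      refine add_mem (mul_mem_bisupp hX hr fun s hs t ht => ?_) (ordLE_mono ?_ hr')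
      · simp only [Set.mem_ofPred_eq, Prod.snd_add] at hs ht ⊢
        push_cast
        omega
      · push_cast
        omega
    · have hX : term 0 (α + Finsupp.single i 1) 1 =
          (Polynomial.C (MvPolynomial.X i) : SymbolRing σ) * term 0 α 1 := by
        have := term_mul_term 0 0 (Finsupp.single i 1) α (1 : Germs σ) 1
        rw [zero_add, one_mul, add_comm] at this
        exact this.symm
      rw [← del_mul_dpow, mul_assoc, ih, ih', hX]
      exact congrArg _ (by ring)

/-- The symbol of a product is the product of the symbols. -/
theorem exists_normalOp_mul_normalOp {d e : ℤ} {p q : SymbolRing σ} (hp : p ∈ ordLE σ d)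
    (hq : q ∈ ordLE σ e) :
    ∃ r ∈ ordLE σ (d + e - 1), normalOp σ p * normalOp σ q = normalOp σ (p * q + r) := by
  induction hp using bisupp_induction with
  | zero => exact ⟨0, zero_mem _, by simp⟩
  | add p p' _ _ hp hp' =>
    obtain ⟨r, hr, hp⟩ := hp
    obtain ⟨s, hs, hp'⟩ := hp'
    refine ⟨r + s, add_mem hr hs, ?_⟩
    rw [map_add, add_mul, hp, hp', ← map_add]
    congr 1
    ring
  | term a α f h =>
    obtain ⟨r, hr, hrq⟩ := exists_dpow_mul_normalOp α hq
    have hα : (α.degree : ℤ) ≤ d := h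
    refine ⟨term a 0 f * r, mul_mem_bisupp (S := {s | s.2 = 0}) (term_mem_bisupp f ?_) hr ?_, ?_⟩
    · simp [bidegree]
    · intro s hs t ht
      simp only [Set.mem_ofPred_eq, Prod.snd_add] at hs ht ⊢
      omega
    · rw [normalOp_term, mul_assoc, hrq, ← normalOp_germ_mul, mul_add, ← mul_assoc, term_mul_term]
      simp

/-! ### Recovering the symbol from the operator -/

theorem adGerm_iterate_dpow {γ : Germs (Option σ)} {v : Option σ → Germs σ}
    (hv : ∀ i, partialDeriv i γ = pullback (v i)) (α : Option σ →₀ ℕ) :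
    (adGerm γ ^ α.degree) (dpow α) =
      α.degree.factorial • ofGerm (pullback (MvPolynomial.eval v (MvPolynomial.monomial α 1))) := by
  induction α using finsupp_nat_induction with
  | zero =>
    rw [← pullbackHom_apply, MvPolynomial.monomial_zero', MvPolynomial.C_1, map_one, map_one]
    simp [dpow_zero, ofGerm_one]
  | add_single α i ih =>
    have h0 : (adGerm γ ^ (α.degree + 1)) (dpow α) = 0 := by
      apply adGerm_iterate_eq_zero
      push_cast
      rw [add_sub_cancel_right]
      exact dpow_mem_orderFiltration α
    rw [map_add, Finsupp.degree_single, ← del_mul_dpow, adGerm_iterate_del_mul, h0, mul_zero,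
      zero_add, ih, hv, mul_smul_comm, smul_smul, ← ofGerm_mul, Nat.factorial_succ,
      MvPolynomial.monomial_add_single, pow_one, map_mul, MvPolynomial.eval_X]
    congr 2
    rw [← pullbackHom_apply, ← pullbackHom_apply, ← pullbackHom_apply, map_mul, mul_comm]

/-- Iterated commutators with a germ `γ` evaluate the principal symbol at the differential
of `γ`. -/
theorem adGerm_iterate_normalOp {γ : Germs (Option σ)} {v : Option σ → Germs σ}
    (hv : ∀ i, partialDeriv i γ = pullback (v i)) {l : ℕ} {q : SymbolRing σ}
    (hq : q ∈ homog σ l) :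
    (adGerm γ ^ l) (normalOp σ q) = l.factorial • ofGerm
      ((q.map (MvPolynomial.eval v)).eval₂ (pullbackHom σ).toRingHom (coord none)) := by
  induction hq using bisupp_induction with
  | zero => simp [ofGerm_zero]
  | add p q _ _ hp hq =>
    rw [map_add, map_add, hp, hq, Polynomial.map_add, Polynomial.eval₂_add, ofGerm_add, smul_add]
  | term a α f h =>
    have hα : α.degree = l := Int.natCast_inj.1 h
    subst hα
    rw [normalOp_term, adGerm_iterate_ofGerm_mul, adGerm_iterate_dpow hv, mul_smul_comm,
      ← ofGerm_mul, term, Polynomial.map_monomial, Polynomial.eval₂_monomial]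
    congr 2
    rw [← mul_one f, ← smul_eq_mul f 1, ← MvPolynomial.smul_monomial, MvPolynomial.smul_eval]
    have : ∀ x : Germs σ, (pullbackHom σ).toRingHom x = pullback x := fun _ => rfl
    simp only [this, smul_eq_mul, mul_one]
    rw [← pullbackHom_apply, ← pullbackHom_apply, ← pullbackHom_apply, map_mul]
    ring

/-! ### The V-filtration in terms of symbols -/

theorem dpow_mem_vFiltration (α : Option σ →₀ ℕ) :
    dpow α ∈ vFiltration (none : Option σ) (-(α none : ℤ)) := by
  induction α using finsupp_nat_induction with
  | zero => simpa [dpow_zero] using one_mem_vFiltration (none : Option σ)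
  | add_single α i ih =>
    rw [← del_mul_dpow]
    cases i with
    | none =>
      refine vFiltration_anti _ ?_ (mul_mem_vFiltration (del_mem_vFiltration none) ih)
      simp
    | some i =>
      refine vFiltration_anti _ ?_ (mul_mem_vFiltration (del_mem_vFiltration_of_ne (by simp)) ih)
      simp

theorem normalOp_mem_vFiltration {k : ℤ} {q : SymbolRing σ} (hq : q ∈ weightGE σ k) :
    normalOp σ q ∈ vFiltration (none : Option σ) k := by
  induction hq using bisupp_induction with
  | zero => rw [map_zero]; exact zero_mem _
  | add p q _ _ hp hq => rw [map_add]; exact add_mem hp hq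
  | term a α f h =>
    rw [normalOp_term, ofGerm_mul, ofGerm_pow]
    have h' : k ≤ a - α none := h
    refine vFiltration_anti _ ?_ (mul_mem_vFiltration (mul_mem_vFiltration
      (coord_pow_mem_vFiltration none a) (ofGerm_mem_vFiltration none _)) (dpow_mem_vFiltration α))
    omega

theorem adGerm_coord_dpow {κ : Type} (i : κ) (α : κ →₀ ℕ) :
    adGerm (coord i) (dpow α) = α i • dpow (α - Finsupp.single i 1) := by
  classical
  induction α using finsupp_nat_induction with
  | zero => simp [dpow_zero, adGerm_apply]
  | add_single α j ih =>
    rw [← del_mul_dpow, adGerm_mul, adGerm_del, ih, partialDeriv_coord, mul_smul_comm,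
      del_mul_dpow]
    rcases eq_or_ne j i with rfl | hij
    · rw [if_pos rfl, ofGerm_one, one_mul, add_tsub_cancel_right, Finsupp.add_apply,
        Finsupp.single_eq_same, succ_nsmul]
      congr 1
      by_cases h : α j = 0
      · rw [h, zero_smul, zero_smul]
      · rw [tsub_add_cancel_of_le (Finsupp.single_le_iff.2 (by omega))]
    · rw [if_neg hij, ofGerm_zero, zero_mul, add_zero, Finsupp.add_apply,
        Finsupp.single_eq_of_ne (Ne.symm hij), add_zero]
      by_cases h : α i = 0
      · rw [h, zero_smul, zero_smul]
      · rw [tsub_add_eq_add_tsub (Finsupp.single_le_iff.2 (by omega))]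

/-- The commutator with the coordinate `x_i` differentiates the symbol by `σ(∂_i)`. -/
theorem exists_adGerm_coord_normalOp (i : Option σ) (q : SymbolRing σ) :
    ∃ r, adGerm (coord i) (normalOp σ q) = normalOp σ r ∧ ∀ a α,
      MvPolynomial.coeff α (r.coeff a) =
        MvPolynomial.coeff (α + Finsupp.single i 1) (q.coeff a) * (α i + 1) := by
  classical
  induction q using symbolRing_induction with
  | zero => exact ⟨0, by simp, by simp⟩
  | add p q hp hq =>
    obtain ⟨r, hr, hr'⟩ := hp
    obtain ⟨s, hs, hs'⟩ := hq
    refine ⟨r + s, by rw [map_add, map_add, map_add, hr, hs], fun a α => ?_⟩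
    rw [Polynomial.coeff_add, MvPolynomial.coeff_add, hr', hs', Polynomial.coeff_add,
      MvPolynomial.coeff_add, add_mul]
  | term a α f =>
    refine ⟨Polynomial.monomial a (MvPolynomial.pderiv i (MvPolynomial.monomial α f)), ?_, ?_⟩
    · rw [normalOp_term, adGerm_ofGerm_mul, adGerm_coord_dpow, MvPolynomial.pderiv_monomial]
      change _ = normalOp σ (term a (α - Finsupp.single i 1) (f * α i))
      rw [normalOp_term, mul_comm f, ← nsmul_eq_mul, ← pullbackHom_apply, ← pullbackHom_apply,
        map_nsmul, mul_smul_comm, mul_smul_comm, ← smul_mul_assoc]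
      congr 1
      exact (map_nsmul (ofGermHom _) _ _).symm
    · intro b β
      rw [term, Polynomial.coeff_monomial, Polynomial.coeff_monomial]
      split_ifs with h
      · rw [MvPolynomial.coeff_pderiv]
      · simp

theorem normalOp_map_C (p : Polynomial (Germs σ)) :
    normalOp σ (p.map MvPolynomial.C) =
      ofGerm (p.eval₂ (pullbackHom σ).toRingHom (coord none)) := by
  induction p using Polynomial.induction_on' with
  | add p q hp hq =>
    rw [Polynomial.map_add, map_add, hp, hq, Polynomial.eval₂_add, ofGerm_add]
  | monomial a f =>
    rw [Polynomial.map_monomial, Polynomial.eval₂_monomial]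
    change normalOp σ (term a 0 f) = _
    rw [normalOp_term, dpow_zero, mul_one, mul_comm]
    rfl

instance : CharZero (Germs σ) :=
  charZero_of_injective_algebraMap (algebraMap ℂ (Germs σ)).injective

theorem mem_weightGE_of_coeff_zero {k : ℤ} {q : SymbolRing σ}
    (key : ∀ a α, α ≠ 0 → MvPolynomial.coeff α (q.coeff a) ≠ 0 → k ≤ (bidegree a α).1)
    (hqk : normalOp σ q ∈ vFiltration (none : Option σ) k) : q ∈ weightGE σ k := by
  classical
  intro a α hα
  by_cases h0 : α = 0
  · subst h0
    set p : Polynomial (Germs σ) := q.map MvPolynomial.constantCoeff with hp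
    have hrest : q - p.map MvPolynomial.C ∈ weightGE σ k := by
      intro b β hβ
      rw [Polynomial.coeff_sub, MvPolynomial.coeff_sub, Polynomial.coeff_map, hp,
        Polynomial.coeff_map, MvPolynomial.coeff_C, MvPolynomial.constantCoeff_eq] at hβ
      split_ifs at hβ with h
      · subst h; simp at hβ
      · exact key b β (Ne.symm h) (by simpa using hβ)
    have h1 := sub_mem hqk (normalOp_mem_vFiltration hrest)
    rw [← map_sub, sub_sub_cancel, normalOp_map_C] at h1
    have h2 := h1 0 1 (mem_divisorIdealPow.2 ⟨1, by simp⟩)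
    rw [act_ofGerm, mul_one] at h2
    obtain ⟨g, hg⟩ := mem_divisorIdealPow.1 h2
    by_contra hlt
    refine hα ?_
    have := coeff_eq_zero_of_dvd_eval₂ _ p g hg a ?_
    · rwa [hp, Polynomial.coeff_map, MvPolynomial.constantCoeff_eq] at this
    · simp [bidegree] at hlt
      omega
  · exact key a α h0 hα

/-- An operator with coefficients polynomial in `t` lies in `V^k` only if all its terms do: the
terms of positive order are detected by commutators with the coordinates, the remaining one by the
action on `1`. -/
theorem mem_weightGE_of_normalOp_mem (d : ℕ) : ∀ (k : ℤ) (q : SymbolRing σ), q ∈ ordLE σ d →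
    normalOp σ q ∈ vFiltration (none : Option σ) k → q ∈ weightGE σ k := by
  classical
  induction d with
  | zero =>
    intro k q hq hqk
    refine mem_weightGE_of_coeff_zero (fun a α hα hα' => ?_) hqk
    have : (α.degree : ℤ) ≤ 0 := hq a α hα'
    exact absurd ((Finsupp.degree_eq_zero_iff α).1 (by omega)) hα
  | succ d ih =>
    intro k q hq hqk
    refine mem_weightGE_of_coeff_zero (fun a α hα hα' => ?_) hqk
    obtain ⟨i, hi⟩ : ∃ i, α i ≠ 0 := by
      by_contra! h
      exact hα (Finsupp.ext h)
    obtain ⟨β, rfl⟩ : ∃ β, α = β + Finsupp.single i 1 :=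
      ⟨α - Finsupp.single i 1, (tsub_add_cancel_of_le (Finsupp.single_le_iff.2 (by omega))).symm⟩
    obtain ⟨r, hr, hrc⟩ := exists_adGerm_coord_normalOp i q
    have hrd : r ∈ ordLE σ d := by
      intro b γ hγ
      rw [hrc] at hγ
      have h1 : ((γ + Finsupp.single i 1).degree : ℤ) ≤ (d + 1 : ℕ) :=
        hq b _ (left_ne_zero_of_mul hγ)
      rw [map_add, Finsupp.degree_single] at h1
      change (γ.degree : ℤ) ≤ d
      push_cast at h1
      omega
    have hβ : MvPolynomial.coeff β (r.coeff a) ≠ 0 := by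
      rw [hrc]
      exact mul_ne_zero hα' (Nat.cast_add_one_ne_zero _)
    cases i with
    | none =>
      have h1 := ih (k + 1) r hrd
        (hr ▸ adGerm_mem_vFiltration hqk (coord_mem_vFiltration none)) a β hβ
      have h2 : k + 1 ≤ a - β none := h1
      simp only [bidegree, Finsupp.add_apply, Finsupp.single_eq_same]
      push_cast
      omega
    | some i =>
      have h1 := ih (k + 0) r hrd
        (hr ▸ adGerm_mem_vFiltration hqk (ofGerm_mem_vFiltration none _)) a β hβ
      have h2 : k + 0 ≤ a - β none := h1
      simp only [bidegree, Finsupp.add_apply, Finsupp.single_apply]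
      simp
      omega

/-! ### Truncation in `t` -/

theorem exists_germ_truncation (N : ℕ) (f : Germs (Option σ)) :
    ∃ (p : Polynomial (Germs σ)) (g : Germs (Option σ)),
      f = p.eval₂ (pullbackHom σ).toRingHom (coord none) + coord none ^ N * g := by
  induction N generalizing f with
  | zero => exact ⟨0, f, by simp⟩
  | succ N ih =>
    obtain ⟨f₀, q, hq⟩ := exists_eq_pullback_add f
    obtain ⟨p, g, hp⟩ := ih q
    refine ⟨Polynomial.C f₀ + Polynomial.X * p, g, ?_⟩
    rw [Polynomial.eval₂_add, Polynomial.eval₂_mul, Polynomial.eval₂_X, Polynomial.eval₂_C, hq]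
    have : (pullbackHom σ).toRingHom f₀ = pullback f₀ := rfl
    rw [this]
    linear_combination coord none * hp

theorem normalOp_map_monomial (p : Polynomial (Germs σ)) (α : Option σ →₀ ℕ) :
    normalOp σ (p.map MvPolynomial.C * term 0 α 1) =
      ofGerm (p.eval₂ (pullbackHom σ).toRingHom (coord none)) * dpow α := by
  induction p using Polynomial.induction_on' with
  | add p q hp hq =>
    rw [Polynomial.map_add, add_mul, map_add, hp, hq, Polynomial.eval₂_add, ofGerm_add, add_mul]
  | monomial a f =>
    rw [Polynomial.map_monomial, Polynomial.eval₂_monomial]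
    change normalOp σ (term a 0 f * term 0 α 1) = _
    rw [term_mul_term, normalOp_term, mul_one, add_zero, zero_add, mul_comm (coord none ^ a)]
    rfl

/-- Modulo `t^N`, every operator has coefficients polynomial in `t`. -/
theorem exists_truncation (N : ℕ) {l : ℤ} {P : DiffOp (Option σ)}
    (hP : P ∈ orderFiltration (Option σ) l) :
    ∃ q ∈ ordLE σ l, ∃ E ∈ orderFiltration (Option σ) l,
      P = normalOp σ q + ofGerm (coord none) ^ N * E := by
  induction hP using Submodule.span_induction with
  | mem P hP =>
    obtain ⟨f, L, hL, rfl⟩ := hP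
    obtain ⟨p, g, rfl⟩ := exists_germ_truncation N f
    classical
    set α : Option σ →₀ ℕ := Multiset.toFinsupp (L : Multiset (Option σ)) with hα
    have hLα : (L : Multiset (Option σ)) = α.toMultiset := by simp [hα]
    have hdeg : (α.degree : ℤ) ≤ l := by
      rw [← length_toList_toMultiset, ← hLα, Multiset.length_toList, Multiset.coe_card]
      exact hL
    refine ⟨p.map MvPolynomial.C * term 0 α 1, ?_, ofGerm g * (L.map del).prod,
      mem_orderFiltration_of_length _ _ hL, ?_⟩
    · refine mul_mem_bisupp (S := {s | s.2 = 0}) ?_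
        (term_mem_bisupp (S := {s | s.2 ≤ l}) 1 hdeg) ?_
      · intro b β hβ
        rw [Polynomial.coeff_map, MvPolynomial.coeff_C] at hβ
        split_ifs at hβ with h
        · subst h; simp [bidegree]
        · exact absurd rfl hβ
      · intro s hs t ht
        simp only [Set.mem_ofPred_eq, Prod.snd_add] at hs ht ⊢
        omega
    · rw [normalOp_map_monomial, ← list_prod_del hLα, ofGerm_add, ofGerm_mul (coord none ^ N),
        ofGerm_pow, add_mul, mul_assoc]
  | zero => exact ⟨0, zero_mem _, 0, zero_mem _, by simp⟩
  | add P Q _ _ hP hQ =>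
    obtain ⟨q, hq, E, hE, rfl⟩ := hP
    obtain ⟨q', hq', E', hE', rfl⟩ := hQ
    refine ⟨q + q', add_mem hq hq', E + E', add_mem hE hE', ?_⟩
    rw [map_add, mul_add]
    abel
  | smul c P _ hP =>
    obtain ⟨q, hq, E, hE, rfl⟩ := hP
    refine ⟨term 0 0 (algebraMap ℂ _ c) * q, ?_, c • E, Submodule.smul_mem _ c hE, ?_⟩
    · refine mul_mem_bisupp (S := {s | s.2 = 0}) (term_mem_bisupp _ (by simp [bidegree])) hq ?_
      intro s hs t ht
      simp only [Set.mem_ofPred_eq, Prod.snd_add] at hs ht ⊢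
      omega
    · rw [normalOp_germ_mul, pow_zero, one_mul, ← pullbackHom_apply, AlgHom.commutes,
        ← smul_eq_ofGerm_mul, smul_add, mul_smul_comm]

/-! ### The bigrading of the symbol ring -/

open Classical in
/-- The projection to the terms of bidegree in `S`, on the coefficient of `t^a`. -/
def bprojCoeff (S : Set (ℤ × ℤ)) (a : ℕ) :
    MvPolynomial (Option σ) (Germs σ) →+ SymbolRing σ :=
  AddMonoidAlgebra.liftNC
    ((Polynomial.C.comp MvPolynomial.C : Germs σ →+* SymbolRing σ) : Germs σ →+ SymbolRing σ)
    (fun α => if bidegree a α.toAdd ∈ S then term a α.toAdd 1 else 0)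

/-- The projection of a symbol to its terms of bidegree in `S`. -/
def bproj (S : Set (ℤ × ℤ)) : SymbolRing σ →+ SymbolRing σ where
  toFun q := q.sum fun a p => bprojCoeff S a p
  map_zero' := Polynomial.sum_zero_index _
  map_add' _ _ := Polynomial.sum_add_index _ _ _ (fun _ => map_zero _) (fun _ _ _ => map_add _ _ _)

open Classical in
theorem bproj_term (S : Set (ℤ × ℤ)) (a : ℕ) (α : Option σ →₀ ℕ) (f : Germs σ) :
    bproj S (term a α f) = if bidegree a α ∈ S then term a α f else 0 := by
  have h1 : bproj S (term a α f) = bprojCoeff S a (MvPolynomial.monomial α f) :=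
    Polynomial.sum_monomial_index (MvPolynomial.monomial α f) (fun a p => bprojCoeff S a p)
      (map_zero _)
  have h2 : bprojCoeff S a (MvPolynomial.monomial α f) =
      term 0 0 f * if bidegree a α ∈ S then term a α 1 else 0 :=
    AddMonoidAlgebra.liftNC_single _ _ _ _
  rw [h1, h2]
  split_ifs
  · rw [term_mul_term, zero_add, zero_add, mul_one]
  · rw [mul_zero]

theorem bproj_term_of_mem {S : Set (ℤ × ℤ)} {a : ℕ} {α : Option σ →₀ ℕ} (f : Germs σ)
    (h : bidegree a α ∈ S) : bproj S (term a α f) = term a α f := by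
  rw [bproj_term, if_pos h]

theorem bproj_term_of_notMem {S : Set (ℤ × ℤ)} {a : ℕ} {α : Option σ →₀ ℕ} (f : Germs σ)
    (h : bidegree a α ∉ S) : bproj S (term a α f) = 0 := by
  rw [bproj_term, if_neg h]

theorem bproj_mem {S T : Set (ℤ × ℤ)} {q : SymbolRing σ} (hq : q ∈ bisupp σ T) :
    bproj S q ∈ bisupp σ (T ∩ S) := by
  induction hq using bisupp_induction with
  | zero => rw [map_zero]; exact zero_mem _
  | add p q _ _ hp hq => rw [map_add]; exact add_mem hp hq
  | term a α f h =>
    by_cases hS : bidegree a α ∈ S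
    · rw [bproj_term_of_mem f hS]; exact term_mem_bisupp f ⟨h, hS⟩
    · rw [bproj_term_of_notMem f hS]; exact zero_mem _

theorem bproj_mem_self (S : Set (ℤ × ℤ)) (q : SymbolRing σ) : bproj S q ∈ bisupp σ S :=
  bisupp_mono Set.inter_subset_right (bproj_mem (T := Set.univ) fun _ _ _ => trivial)

theorem bproj_congr {S S' T : Set (ℤ × ℤ)} {q : SymbolRing σ} (hq : q ∈ bisupp σ T)
    (h : ∀ s ∈ T, s ∈ S ↔ s ∈ S') : bproj S q = bproj S' q := by
  induction hq using bisupp_induction with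
  | zero => rw [map_zero, map_zero]
  | add p q _ _ hp hq => rw [map_add, map_add, hp, hq]
  | term a α f ha =>
    by_cases hS : bidegree a α ∈ S
    · rw [bproj_term_of_mem f hS, bproj_term_of_mem f ((h _ ha).1 hS)]
    · rw [bproj_term_of_notMem f hS, bproj_term_of_notMem f (fun h' => hS ((h _ ha).2 h'))]

theorem bproj_of_mem {S : Set (ℤ × ℤ)} {q : SymbolRing σ} (hq : q ∈ bisupp σ S) :
    bproj S q = q := by
  induction hq using bisupp_induction with
  | zero => rw [map_zero]
  | add p q _ _ hp hq => rw [map_add, hp, hq]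
  | term a α f h => rw [bproj_term_of_mem f h]

theorem bproj_add_compl (S : Set (ℤ × ℤ)) (q : SymbolRing σ) : bproj S q + bproj Sᶜ q = q := by
  induction q using symbolRing_induction with
  | zero => simp
  | add p q hp hq => rw [map_add, map_add, add_add_add_comm, hp, hq]
  | term a α f =>
    by_cases hS : bidegree a α ∈ S
    · rw [bproj_term_of_mem f hS, bproj_term_of_notMem f (Set.notMem_compl_iff.2 hS), add_zero]
    · rw [bproj_term_of_notMem f hS, bproj_term_of_mem f hS, zero_add]

theorem bproj_eq_zero {S T : Set (ℤ × ℤ)} {q : SymbolRing σ} (hq : q ∈ bisupp σ T)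
    (h : ∀ s ∈ T, s ∉ S) : bproj S q = 0 := by
  have h1 : bproj Sᶜ q = q := bproj_of_mem (bisupp_mono (fun s hs => h s hs) hq)
  have h2 := bproj_add_compl S q
  rw [h1] at h2
  exact add_eq_right.1 h2

theorem sub_bproj_mem {S T : Set (ℤ × ℤ)} {q : SymbolRing σ} (hq : q ∈ bisupp σ T) :
    q - bproj S q ∈ bisupp σ (T ∩ Sᶜ) := by
  rw [sub_eq_of_eq_add' (bproj_add_compl S q).symm]
  exact bproj_mem hq

/-- Multiplication by a bihomogeneous symbol commutes with projections, up to a shift. -/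
theorem bproj_mul {s₀ : ℤ × ℤ} {g : SymbolRing σ} (hg : g ∈ bisupp σ {s₀}) (S : Set (ℤ × ℤ))
    (q : SymbolRing σ) : bproj S (q * g) = bproj {s | s + s₀ ∈ S} q * g := by
  induction hg using bisupp_induction with
  | zero => simp
  | add p p' _ _ hp hp' => rw [mul_add, map_add, hp, hp', mul_add]
  | term b β g hb =>
    rw [Set.mem_singleton_iff] at hb
    induction q using symbolRing_induction with
    | zero => simp
    | add p q hp hq => rw [add_mul, map_add, hp, hq, map_add, add_mul]
    | term a α f =>
      rw [term_mul_term]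
      by_cases h : bidegree a α + s₀ ∈ S
      · rw [bproj_term_of_mem f (show bidegree a α ∈ {s | s + s₀ ∈ S} from h), bproj_term_of_mem,
          term_mul_term]
        rwa [bidegree_add, hb]
      · rw [bproj_term_of_notMem f (show bidegree a α ∉ {s | s + s₀ ∈ S} from h),
          bproj_term_of_notMem, zero_mul]
        rwa [bidegree_add, hb]

/-- An ideal generated by bihomogeneous symbols is stable under projections. -/
theorem bproj_mem_span {A : Set (SymbolRing σ)} (hA : ∀ g ∈ A, ∃ s₀, g ∈ bisupp σ {s₀})
    {q : SymbolRing σ} (hq : q ∈ Ideal.span A) (S : Set (ℤ × ℤ)) :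
    bproj S q ∈ Ideal.span A := by
  induction hq using Submodule.span_induction generalizing S with
  | mem g hg =>
    obtain ⟨s₀, hs₀⟩ := hA g hg
    rw [← one_mul g, bproj_mul hs₀]
    exact Ideal.mul_mem_left _ _ (Ideal.subset_span hg)
  | zero => rw [map_zero]; exact zero_mem _
  | add p q _ _ hp hq => rw [map_add]; exact add_mem (hp S) (hq S)
  | smul a q _ hq =>
    rw [smul_eq_mul]
    induction a using symbolRing_induction with
    | zero => rw [zero_mul, map_zero]; exact zero_mem _
    | add a b ha hb => rw [add_mul, map_add]; exact add_mem ha hb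
    | term a α f =>
      rw [mul_comm, bproj_mul (term_mem_bisupp f (Set.mem_singleton _))]
      exact Ideal.mul_mem_right _ _ (hq _)

theorem exists_weight_bounds (q : SymbolRing σ) :
    ∃ w w' : ℤ, q ∈ bisupp σ {s | w ≤ s.1} ∧ q ∈ bisupp σ {s | s.1 < w'} := by
  induction q using symbolRing_induction with
  | zero => exact ⟨0, 0, zero_mem _, zero_mem _⟩
  | add p q hp hq =>
    obtain ⟨w, w', h, h'⟩ := hp
    obtain ⟨v, v', k, k'⟩ := hq
    refine ⟨min w v, max w' v', add_mem (bisupp_mono ?_ h) (bisupp_mono ?_ k),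
      add_mem (bisupp_mono ?_ h') (bisupp_mono ?_ k')⟩ <;>
    · intro s hs
      simp only [Set.mem_ofPred_eq] at hs ⊢
      omega
  | term a α f =>
    exact ⟨(bidegree a α).1, (bidegree a α).1 + 1, term_mem_bisupp f (le_refl (bidegree a α).1),
      term_mem_bisupp f (lt_add_one (bidegree a α).1)⟩

/-! ### Regularity -/

/-- If `h, r_1, …, r_m` is weakly regular, then `h` is regular modulo `r_1, …, r_m`. -/
theorem mem_ofList_of_mul_mem {R : Type*} [CommRing R] {h : R} {rs : List R}
    (hreg : RingTheory.Sequence.IsWeaklyRegular R (h :: rs)) {a : R}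
    (ha : h * a ∈ Ideal.ofList rs) : a ∈ Ideal.ofList rs := by
  induction rs using List.reverseRecOn generalizing a with
  | nil =>
    have h0 := hreg.regular_mod_prev 0 (by simp)
    rw [isSMulRegular_quotient_iff_mem_of_smul_mem] at h0
    simpa using h0 a (by simpa using ha)
  | append_singleton rs r ih =>
    have hlast := hreg.regular_mod_prev (rs.length + 1) (by simp)
    rw [isSMulRegular_quotient_iff_mem_of_smul_mem] at hlast
    have hr : ∀ c, r * c ∈ Ideal.span {h} ⊔ Ideal.ofList rs →
        c ∈ Ideal.span {h} ⊔ Ideal.ofList rs := by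
      intro c hc
      simpa using hlast c (by simpa using hc)
    rw [← List.cons_append, RingTheory.Sequence.isWeaklyRegular_append_iff] at hreg
    rw [Ideal.ofList_append, Ideal.ofList_singleton] at ha ⊢
    obtain ⟨x, hx, y, hy, hxy⟩ := Submodule.mem_sup.1 ha
    obtain ⟨c, rfl⟩ := Ideal.mem_span_singleton'.1 hy
    obtain ⟨y, hy, z, hz, hyz⟩ := Submodule.mem_sup.1 (hr c (by
      rw [show r * c = h * a - x by rw [← hxy]; ring]
      exact sub_mem (Ideal.mem_sup_left (Ideal.mul_mem_right _ _ (Ideal.mem_span_singleton_self h)))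
        (Ideal.mem_sup_right hx)))
    obtain ⟨d, rfl⟩ := Ideal.mem_span_singleton'.1 hy
    have h1 : a - d * r ∈ Ideal.ofList rs := by
      apply ih hreg.1
      rw [show h * (a - d * r) = x + z * r by rw [mul_sub, ← hxy, ← hyz]; ring]
      exact add_mem hx (Ideal.mul_mem_right _ _ hz)
    rw [← sub_add_cancel a (d * r)]
    exact add_mem (Ideal.mem_sup_left h1)
      (Ideal.mem_sup_right (Ideal.mul_mem_left _ _ (Ideal.mem_span_singleton_self r)))

/-- The variable `σ(∂_t)` is regular modulo an ideal generated by elements free of it. -/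
theorem mem_of_X_none_mul_mem {A : Set (MvPolynomial (Option σ) (Germs σ))}
    (hA : ∀ g ∈ A, ∃ g₀ : MvPolynomial σ (Germs σ), g = MvPolynomial.rename some g₀)
    {p : MvPolynomial (Option σ) (Germs σ)} (hp : MvPolynomial.X none * p ∈ Ideal.span A) :
    p ∈ Ideal.span A := by
  let φ := MvPolynomial.optionEquivLeft (Germs σ) σ
  have hφ : ∀ g₀ : MvPolynomial σ (Germs σ), φ (MvPolynomial.rename some g₀) = Polynomial.C g₀ := by
    intro g₀
    induction g₀ using MvPolynomial.induction_on with
    | C a => simp [φ]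
    | add p q hp hq => simp only [map_add, hp, hq]
    | mul_X p i hp => simp only [map_mul, hp, MvPolynomial.rename_X, φ,
        MvPolynomial.optionEquivLeft_X_some]
  let B : Ideal (MvPolynomial σ (Germs σ)) := Ideal.span {g₀ | MvPolynomial.rename some g₀ ∈ A}
  have hB : (Ideal.span A).map φ = B.map Polynomial.C := by
    rw [Ideal.map_span, Ideal.map_span]
    congr 1
    ext x
    constructor
    · rintro ⟨g, hg, rfl⟩
      obtain ⟨g₀, rfl⟩ := hA g hg
      exact ⟨g₀, hg, (hφ g₀).symm⟩
    · rintro ⟨g₀, hg, rfl⟩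
      exact ⟨_, hg, hφ g₀⟩
  have key : ∀ q, q ∈ Ideal.span A ↔ φ q ∈ B.map Polynomial.C := by
    intro q
    rw [← hB, Ideal.mem_map_of_equiv]
    exact ⟨fun h => ⟨q, h, rfl⟩, fun ⟨x, hx, hxq⟩ => φ.injective hxq ▸ hx⟩
  rw [key, map_mul, MvPolynomial.optionEquivLeft_X_none, Ideal.mem_map_C_iff] at hp
  rw [key, Ideal.mem_map_C_iff]
  intro n
  have := hp (n + 1)
  rwa [Polynomial.coeff_X_mul] at this

/-- The symbol `c + t σ(∂_t)`. -/
def eulerSymbol (c : MvPolynomial (Option σ) (Germs σ)) : SymbolRing σ :=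
  Polynomial.C c + Polynomial.C (MvPolynomial.X none) * Polynomial.X

/-- If `σ(∂_t)` is regular modulo `I`, then `c + t σ(∂_t)` is regular modulo `I[t]`: look at the
coefficients of the powers of `t`, from the top down. -/
theorem mem_of_mul_eulerSymbol_mem {I : Ideal (MvPolynomial (Option σ) (Germs σ))}
    (hI : ∀ p, MvPolynomial.X none * p ∈ I → p ∈ I) {c : MvPolynomial (Option σ) (Germs σ)}
    {v : SymbolRing σ} (hv : v * eulerSymbol c ∈ I.map Polynomial.C) :
    v ∈ I.map Polynomial.C := by
  rw [Ideal.mem_map_C_iff] at hv ⊢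
  have hstep : ∀ n, v.coeff (n + 1) ∈ I → v.coeff n ∈ I := by
    intro n hn
    apply hI
    have h1 := hv (n + 1)
    have h2 : v * eulerSymbol c = Polynomial.C c * v +
        Polynomial.C (MvPolynomial.X none) * v * Polynomial.X := by
      rw [eulerSymbol]; ring
    rw [h2, Polynomial.coeff_add, Polynomial.coeff_C_mul, Polynomial.coeff_mul_X,
      Polynomial.coeff_C_mul] at h1
    have h3 := sub_mem h1 (I.mul_mem_left c hn)
    rwa [add_sub_cancel_left] at h3
  have htop : ∀ k n, v.natDegree + 1 ≤ n + k → v.coeff n ∈ I := by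
    intro k
    induction k with
    | zero =>
      intro n hn
      rw [Polynomial.coeff_eq_zero_of_natDegree_lt (by omega)]
      exact zero_mem _
    | succ k ih => exact fun n hn => hstep n (ih (n + 1) (by omega))
  exact fun n => htop (v.natDegree + 1) n (by omega)

variable {κ : Type}

/-- The ideal generated by the symbols `r_i` and `c + t σ(∂_t)`. -/
def eulerIdeal (r : κ → MvPolynomial (Option σ) (Germs σ))
    (c : MvPolynomial (Option σ) (Germs σ)) : Ideal (SymbolRing σ) :=
  (Ideal.span (Set.range r)).map Polynomial.C ⊔ Ideal.span {eulerSymbol c}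

theorem eulerIdeal_eq_span (r : κ → MvPolynomial (Option σ) (Germs σ))
    (c : MvPolynomial (Option σ) (Germs σ)) :
    eulerIdeal r c = Ideal.span (Set.range (fun i => Polynomial.C (r i)) ∪ {eulerSymbol c}) := by
  rw [Ideal.span_union, eulerIdeal, Ideal.map_span, ← Set.range_comp]
  rfl

theorem mem_map_C_span_range [Fintype κ] {r : κ → MvPolynomial (Option σ) (Germs σ)}
    {q : SymbolRing σ} :
    q ∈ (Ideal.span (Set.range r)).map Polynomial.C ↔
      ∃ a : κ → SymbolRing σ, q = ∑ i, a i * Polynomial.C (r i) := by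
  rw [Ideal.map_span, ← Set.range_comp, Ideal.span, Submodule.mem_span_range_iff_exists_fun]
  exact exists_congr fun a => ⟨fun h => h.symm, fun h => h.symm⟩

theorem mem_eulerIdeal [Fintype κ] {r : κ → MvPolynomial (Option σ) (Germs σ)}
    {c : MvPolynomial (Option σ) (Germs σ)} {q : SymbolRing σ} :
    q ∈ eulerIdeal r c ↔ ∃ (a : κ → SymbolRing σ) (b : SymbolRing σ),
      q = ∑ i, a i * Polynomial.C (r i) + b * eulerSymbol c := by
  rw [eulerIdeal, Submodule.mem_sup]
  constructor
  · rintro ⟨y, hy, z, hz, rfl⟩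
    obtain ⟨a, rfl⟩ := mem_map_C_span_range.1 hy
    obtain ⟨b, rfl⟩ := Ideal.mem_span_singleton'.1 hz
    exact ⟨a, b, rfl⟩
  · rintro ⟨a, b, rfl⟩
    exact ⟨_, mem_map_C_span_range.2 ⟨a, rfl⟩, _, Ideal.mem_span_singleton'.2 ⟨b, rfl⟩, rfl⟩

/-- A symbol with a prescribed set of bidegrees in the ideal generated by the `r_i` is a
combination of the `r_i` with coefficients having the shifted bidegrees. -/
theorem exists_bisupp_of_mem_map_C [Fintype κ] {r : κ → MvPolynomial (Option σ) (Germs σ)}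
    {S : Set (ℤ × ℤ)} (hr : ∀ i, (Polynomial.C (r i) : SymbolRing σ) ∈ bisupp σ {(0, 1)})
    {q : SymbolRing σ} (hq : q ∈ bisupp σ S)
    (hqr : q ∈ (Ideal.span (Set.range r)).map Polynomial.C) :
    ∃ a : κ → SymbolRing σ, (∀ i, a i ∈ bisupp σ {s | s + (0, 1) ∈ S}) ∧
      q = ∑ i, a i * Polynomial.C (r i) := by
  obtain ⟨a, ha⟩ := mem_map_C_span_range.1 hqr
  refine ⟨fun i => bproj _ (a i), fun i => bproj_mem_self _ _, ?_⟩
  rw [← bproj_of_mem hq, ha, map_sum]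
  exact Finset.sum_congr rfl fun i _ => bproj_mul (hr i) S (a i)

theorem exists_bisupp_of_mem_eulerIdeal [Fintype κ]
    {r : κ → MvPolynomial (Option σ) (Germs σ)}
    {c : MvPolynomial (Option σ) (Germs σ)} {S : Set (ℤ × ℤ)}
    (hr : ∀ i, (Polynomial.C (r i) : SymbolRing σ) ∈ bisupp σ {(0, 1)})
    (hc : eulerSymbol c ∈ bisupp σ {(0, 1)}) {q : SymbolRing σ} (hq : q ∈ bisupp σ S)
    (hqr : q ∈ eulerIdeal r c) :
    ∃ (a : κ → SymbolRing σ) (b : SymbolRing σ), (∀ i, a i ∈ bisupp σ {s | s + (0, 1) ∈ S}) ∧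
      b ∈ bisupp σ {s | s + (0, 1) ∈ S} ∧
      q = ∑ i, a i * Polynomial.C (r i) + b * eulerSymbol c := by
  obtain ⟨a, b, ha⟩ := mem_eulerIdeal.1 hqr
  refine ⟨fun i => bproj _ (a i), bproj _ b, fun i => bproj_mem_self _ _, bproj_mem_self _ _, ?_⟩
  rw [← bproj_of_mem hq, ha, map_add, map_sum, bproj_mul hc]
  congr 1
  exact Finset.sum_congr rfl fun i _ => bproj_mul (hr i) S (a i)

theorem bproj_mem_eulerIdeal {r : κ → MvPolynomial (Option σ) (Germs σ)}
    {c : MvPolynomial (Option σ) (Germs σ)}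
    (hr : ∀ i, (Polynomial.C (r i) : SymbolRing σ) ∈ bisupp σ {(0, 1)})
    (hc : eulerSymbol c ∈ bisupp σ {(0, 1)}) {q : SymbolRing σ} (hq : q ∈ eulerIdeal r c)
    (S : Set (ℤ × ℤ)) : bproj S q ∈ eulerIdeal r c := by
  rw [eulerIdeal_eq_span] at hq ⊢
  refine bproj_mem_span ?_ hq S
  rintro g (⟨i, rfl⟩ | rfl)
  · exact ⟨_, hr i⟩
  · exact ⟨_, hc⟩

/-- The germ `h` as a symbol. -/
abbrev germSymbol (h : Germs σ) : SymbolRing σ := Polynomial.C (MvPolynomial.C h)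

theorem germSymbol_mem (h : Germs σ) : germSymbol h ∈ bisupp σ {(0, 0)} :=
  term_mem_bisupp (a := 0) (α := 0) h (by simp [bidegree])

theorem X_mem : (Polynomial.X : SymbolRing σ) ∈ bisupp σ {(1, 0)} :=
  term_mem_bisupp (a := 1) (α := 0) 1 (by simp [bidegree])

/-- The germ `h` is regular modulo the `r_i` and `c + t σ(∂_t)`. In a relation
`u h = ∑ a_i r_i + v (c + t σ(∂_t))`, the cofactor `v` lies in the ideal of the `r_i` and `h`, since
`c + t σ(∂_t)` is regular modulo that ideal, too; so `v (c + t σ(∂_t))` can be absorbed into the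
other two terms. -/
theorem mem_eulerIdeal_of_mul_germSymbol_mem {r : κ → MvPolynomial (Option σ) (Germs σ)}
    {c : MvPolynomial (Option σ) (Germs σ)} {h : Germs σ}
    (hr₀ : ∀ i, ∃ g₀ : MvPolynomial σ (Germs σ), r i = MvPolynomial.rename some g₀)
    (hreg : ∀ p, MvPolynomial.C h * p ∈ Ideal.span (Set.range r) → p ∈ Ideal.span (Set.range r))
    {u : SymbolRing σ} (hu : u * germSymbol h ∈ eulerIdeal r c) : u ∈ eulerIdeal r c := by
  obtain ⟨y, hy, z, hz, hyz⟩ := Submodule.mem_sup.1 hu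
  obtain ⟨v, rfl⟩ := Ideal.mem_span_singleton'.1 hz
  have hle : Ideal.span (Set.range r) ≤ Ideal.span (Set.range r ∪ {MvPolynomial.C h}) :=
    Ideal.span_mono Set.subset_union_left
  have hv : v ∈ (Ideal.span (Set.range r ∪ {MvPolynomial.C h})).map Polynomial.C := by
    refine mem_of_mul_eulerSymbol_mem (c := c) (fun p hp => ?_) ?_
    · refine mem_of_X_none_mul_mem ?_ hp
      rintro g (⟨i, rfl⟩ | rfl)
      · exact hr₀ i
      · exact ⟨MvPolynomial.C h, (MvPolynomial.rename_C _ _).symm⟩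
    · rw [show v * eulerSymbol c = u * germSymbol h - y by rw [← hyz]; ring]
      refine sub_mem (Ideal.mul_mem_left _ _ (Ideal.mem_map_of_mem _ ?_)) (Ideal.map_mono hle hy)
      exact Ideal.subset_span (Or.inr rfl)
  rw [Ideal.span_union, Ideal.map_sup, Ideal.map_span _ {MvPolynomial.C h}, Set.image_singleton]
    at hv
  obtain ⟨v₁, hv₁, z, hz', rfl⟩ := Submodule.mem_sup.1 hv
  obtain ⟨v₂, rfl⟩ := Ideal.mem_span_singleton'.1 hz'
  have h1 : u - v₂ * eulerSymbol c ∈ (Ideal.span (Set.range r)).map Polynomial.C := by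
    rw [Ideal.mem_map_C_iff]
    intro n
    apply hreg
    rw [← Polynomial.coeff_C_mul]
    refine Ideal.mem_map_C_iff.1 ?_ n
    have : Polynomial.C (MvPolynomial.C h) * (u - v₂ * eulerSymbol c) =
        y + v₁ * eulerSymbol c := by
      linear_combination -hyz
    rw [this]
    exact add_mem hy (Ideal.mul_mem_right _ _ hv₁)
  rw [← sub_add_cancel u (v₂ * eulerSymbol c)]
  exact Submodule.add_mem_sup h1 (Ideal.mem_span_singleton'.2 ⟨v₂, rfl⟩)

/-- If `u (t - h)` is of weight at least `k` modulo the ideal `K` generated by the `r_i` and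
`c + t σ(∂_t)`, then so is `u`: the generators of `K` have weight zero, and in lowest weight
`t - h` is `-h`, which is regular modulo `K`. -/
theorem bproj_lt_mem_eulerIdeal {r : κ → MvPolynomial (Option σ) (Germs σ)}
    {c : MvPolynomial (Option σ) (Germs σ)} {h : Germs σ}
    (hr : ∀ i, (Polynomial.C (r i) : SymbolRing σ) ∈ bisupp σ {(0, 1)})
    (hc : eulerSymbol c ∈ bisupp σ {(0, 1)})
    (hreg : ∀ u, u * germSymbol h ∈ eulerIdeal r c → u ∈ eulerIdeal r c) {k : ℤ}
    {u e : SymbolRing σ} (he : e ∈ weightGE σ k)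
    (hu : u * (Polynomial.X - germSymbol h) - e ∈ eulerIdeal r c) :
    ∀ w ≤ k, bproj {s | s.1 < w} u ∈ eulerIdeal r c := by
  obtain ⟨w₀, -, hw₀, -⟩ := exists_weight_bounds u
  have hlow : ∀ w ≤ w₀, bproj {s | s.1 < w} u ∈ eulerIdeal r c := by
    intro w hw
    rw [bproj_eq_zero hw₀ fun s hs hs' => ?_]
    · exact zero_mem _
    · simp only [Set.mem_ofPred_eq] at hs hs'
      omega
  intro w
  rcases le_total w w₀ with hw | hw
  · exact fun _ => hlow w hw
  induction w, hw using Int.leInduction with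
  | base => exact fun _ => hlow w₀ le_rfl
  | succ w hw ih =>
    intro hwk
    apply hreg
    have h1 := bproj_mem_eulerIdeal hr hc hu {s | s.1 < w + 1}
    have h2 : bproj {s : ℤ × ℤ | s.1 < w + 1} e = 0 := by
      refine bproj_eq_zero he fun s hs hs' => ?_
      simp only [Set.mem_ofPred_eq] at hs hs'
      omega
    rw [map_sub, h2, sub_zero, mul_sub, map_sub, bproj_mul X_mem,
      bproj_mul (germSymbol_mem h)] at h1
    have h3 : {s : ℤ × ℤ | s + (1, 0) ∈ {s : ℤ × ℤ | s.1 < w + 1}} = {s | s.1 < w} := by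
      ext s; simp
    have h4 : {s : ℤ × ℤ | s + (0, 0) ∈ {s : ℤ × ℤ | s.1 < w + 1}} = {s | s.1 < w + 1} := by
      ext s; simp
    rw [h3, h4] at h1
    have h5 := sub_mem (Ideal.mul_mem_right Polynomial.X _ (ih (by omega))) h1
    rwa [sub_sub_cancel] at h5

/-- The function `t - h` is regular modulo the `r_i` and `c + t σ(∂_t)`. -/
theorem mem_eulerIdeal_of_mul_graph_mem {r : κ → MvPolynomial (Option σ) (Germs σ)}
    {c : MvPolynomial (Option σ) (Germs σ)} {h : Germs σ}
    (hr : ∀ i, (Polynomial.C (r i) : SymbolRing σ) ∈ bisupp σ {(0, 1)})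
    (hc : eulerSymbol c ∈ bisupp σ {(0, 1)})
    (hreg : ∀ u, u * germSymbol h ∈ eulerIdeal r c → u ∈ eulerIdeal r c) {u : SymbolRing σ}
    (hu : u * (Polynomial.X - germSymbol h) ∈ eulerIdeal r c) : u ∈ eulerIdeal r c := by
  obtain ⟨-, w, -, hw⟩ := exists_weight_bounds u
  rw [← bproj_of_mem hw]
  refine bproj_lt_mem_eulerIdeal hr hc hreg (zero_mem (weightGE σ w)) ?_ w le_rfl
  rwa [sub_zero]

theorem bproj_mul_graph {k l : ℤ} {u : SymbolRing σ} (hu : u ∈ weightGE σ k) (h : Germs σ) :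
    bproj {s | k ≤ s.1 ∧ s.2 = l} (u * (Polynomial.X - germSymbol h)) =
      bproj {s | k ≤ s.1 ∧ s.2 = l} u * (Polynomial.X - germSymbol h) := by
  have h1 : bproj {s : ℤ × ℤ | s + (1, 0) ∈ {s : ℤ × ℤ | k ≤ s.1 ∧ s.2 = l}} u =
      bproj {s | k ≤ s.1 ∧ s.2 = l} u := by
    refine bproj_congr hu fun s hs => ?_
    simp only [Set.mem_ofPred_eq, Prod.fst_add, Prod.snd_add] at hs ⊢
    omega
  have h2 : bproj {s : ℤ × ℤ | s + (0, 0) ∈ {s : ℤ × ℤ | k ≤ s.1 ∧ s.2 = l}} u =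
      bproj {s | k ≤ s.1 ∧ s.2 = l} u := by
    refine bproj_congr hu fun s hs => ?_
    simp
  rw [mul_sub, map_sub, bproj_mul X_mem, bproj_mul (germSymbol_mem h), h1, h2, mul_sub]

/-- Strictness of the generators `r_i`, `c + t σ(∂_t)`, `t - h` with respect to weight and order:
a homogeneous symbol of order `l` and weight at least `k` in the ideal they generate is a
combination of them whose coefficients have the expected orders and weight at least `k`. -/
theorem exists_bisupp_of_mem_graph [Fintype κ] {r : κ → MvPolynomial (Option σ) (Germs σ)}
    {c : MvPolynomial (Option σ) (Germs σ)} {h : Germs σ}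
    (hr : ∀ i, (Polynomial.C (r i) : SymbolRing σ) ∈ bisupp σ {(0, 1)})
    (hc : eulerSymbol c ∈ bisupp σ {(0, 1)})
    (hreg : ∀ u, u * germSymbol h ∈ eulerIdeal r c → u ∈ eulerIdeal r c) {k l : ℤ}
    {e : SymbolRing σ} (he : e ∈ bisupp σ {s | k ≤ s.1 ∧ s.2 = l})
    (heI : e ∈ eulerIdeal r c ⊔ Ideal.span {Polynomial.X - germSymbol h}) :
    ∃ (a : κ → SymbolRing σ) (b u : SymbolRing σ),
      (∀ i, a i ∈ bisupp σ {s | k ≤ s.1 ∧ s.2 = l - 1}) ∧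
      b ∈ bisupp σ {s | k ≤ s.1 ∧ s.2 = l - 1} ∧ u ∈ bisupp σ {s | k ≤ s.1 ∧ s.2 = l} ∧
      e = ∑ i, a i * Polynomial.C (r i) + b * eulerSymbol c +
        u * (Polynomial.X - germSymbol h) := by
  obtain ⟨x, hx, y, hy, hxy⟩ := Submodule.mem_sup.1 heI
  obtain ⟨u, rfl⟩ := Ideal.mem_span_singleton'.1 hy
  have hew : e ∈ weightGE σ k := bisupp_mono (fun s (hs : k ≤ s.1 ∧ s.2 = l) => hs.1) he
  have hue : u * (Polynomial.X - germSymbol h) - e ∈ eulerIdeal r c := by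
    rw [← hxy, sub_add_cancel_right]
    exact neg_mem hx
  have h1 := bproj_lt_mem_eulerIdeal hr hc hreg hew hue k le_rfl
  obtain ⟨u₁, hu₁⟩ : ∃ u₁, bproj {s : ℤ × ℤ | s.1 < k}ᶜ u = u₁ := ⟨_, rfl⟩
  have hu : bproj {s : ℤ × ℤ | s.1 < k} u + u₁ = u := hu₁ ▸ bproj_add_compl _ u
  have hu₁w : u₁ ∈ weightGE σ k := by
    have h0 := bproj_mem_self {s : ℤ × ℤ | s.1 < k}ᶜ u
    rw [hu₁] at h0
    exact bisupp_mono (fun s (hs : ¬ s.1 < k) => not_lt.1 hs) h0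
  have h2 : e - u₁ * (Polynomial.X - germSymbol h) ∈ eulerIdeal r c := by
    rw [← hxy, ← hu, add_mul, ← add_assoc, add_sub_cancel_right]
    exact add_mem hx (Ideal.mul_mem_right _ _ h1)
  have h3 := bproj_mem_eulerIdeal hr hc h2 {s | k ≤ s.1 ∧ s.2 = l}
  rw [map_sub, bproj_of_mem he, bproj_mul_graph hu₁w] at h3
  have h4 : e - bproj {s | k ≤ s.1 ∧ s.2 = l} u₁ * (Polynomial.X - germSymbol h) ∈
      bisupp σ {s | k ≤ s.1 ∧ s.2 = l} := by
    rw [← bproj_mul_graph hu₁w]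
    exact AddSubgroup.sub_mem _ he (bproj_mem_self _ _)
  obtain ⟨a, b, ha, hb, hab⟩ := exists_bisupp_of_mem_eulerIdeal hr hc h4 h3
  have hsub : {s : ℤ × ℤ | s + (0, 1) ∈ {s : ℤ × ℤ | k ≤ s.1 ∧ s.2 = l}} ⊆
      {s | k ≤ s.1 ∧ s.2 = l - 1} := by
    intro s hs
    simp only [Set.mem_ofPred_eq, Prod.fst_add, Prod.snd_add] at hs ⊢
    omega
  have hu' := bproj_mem_self {s : ℤ × ℤ | k ≤ s.1 ∧ s.2 = l} u₁
  refine ⟨a, b, _, fun i => bisupp_mono hsub (ha i), bisupp_mono hsub hb, hu', ?_⟩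
  rw [← hab, sub_add_cancel]

end Operators

/-! ### Logarithmic vector fields -/

section VectorFields

variable {n : ℕ}

theorem apply_add (θ η : VectorField n) (f : Germs (Fin n)) :
    (θ + η).apply f = θ.apply f + η.apply f := by
  simp [VectorField.apply, add_mul, Finset.sum_add_distrib]

theorem apply_smul (a : Germs (Fin n)) (θ : VectorField n) (f : Germs (Fin n)) :
    (a • θ).apply f = a * θ.apply f := by
  simp [VectorField.apply, Finset.mul_sum, mul_assoc]

theorem apply_sum {κ : Type*} (s : Finset κ) (θ : κ → VectorField n) (f : Germs (Fin n)) :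
    (∑ i ∈ s, θ i).apply f = ∑ i ∈ s, (θ i).apply f := by
  classical
  induction s using Finset.induction_on with
  | empty => simp [VectorField.apply]
  | insert i s hi ih => rw [Finset.sum_insert hi, Finset.sum_insert hi, apply_add, ih]

theorem apply_zero (θ : VectorField n) : θ.apply 0 = 0 := by
  simp [VectorField.apply]

/-- The symbol of a vector field, as a linear map. -/
def symbolHom (n : ℕ) : VectorField n →ₗ[Germs (Fin n)] TotalGraded n where
  toFun θ := θ.symbol
  map_add' θ η := by simp [VectorField.symbol, add_mul, Finset.sum_add_distrib]
  map_smul' a θ := by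
    simp [VectorField.symbol, Finset.smul_sum, mul_assoc, MvPolynomial.smul_eq_C_mul]

theorem symbol_eq_rename (θ : VectorField n) :
    ∃ g₀ : MvPolynomial (Fin n) (Germs (Fin n)), θ.symbol = MvPolynomial.rename some g₀ :=
  ⟨∑ i, MvPolynomial.C (θ i) * MvPolynomial.X i, by simp [VectorField.symbol]⟩

theorem C_symbol_eq_sum_term (θ : VectorField n) :
    (Polynomial.C θ.symbol : SymbolRing (Fin n)) =
      ∑ i, term 0 (Finsupp.single (some i) 1) (θ i) := by
  rw [VectorField.symbol, map_sum]
  refine Finset.sum_congr rfl fun i _ => ?_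
  rw [MvPolynomial.C_mul_X_eq_monomial]
  rfl

theorem C_symbol_mem (θ : VectorField n) :
    (Polynomial.C θ.symbol : SymbolRing (Fin n)) ∈ bisupp (Fin n) {(0, 1)} := by
  rw [C_symbol_eq_sum_term]
  exact sum_mem fun i _ => term_mem_bisupp _ (by simp [bidegree])

theorem normalOp_symbol (θ : VectorField n) :
    normalOp (Fin n) (Polynomial.C θ.symbol) = θ.lift := by
  rw [C_symbol_eq_sum_term, map_sum, VectorField.lift]
  refine Finset.sum_congr rfl fun i _ => ?_
  rw [normalOp_term, pow_zero, one_mul, dpow_single]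

theorem lift_add (θ η : VectorField n) : (θ + η).lift = θ.lift + η.lift := by
  rw [← normalOp_symbol, ← normalOp_symbol, ← normalOp_symbol, ← map_add, ← map_add]
  exact congrArg _ (congrArg _ (map_add (symbolHom n) θ η))

theorem lift_smul (a : Germs (Fin n)) (θ : VectorField n) :
    (a • θ).lift = ofGerm (pullback a) * θ.lift := by
  simp only [VectorField.lift, Finset.mul_sum, ← mul_assoc, ← ofGerm_mul]
  refine Finset.sum_congr rfl fun i _ => ?_
  congr 2
  exact map_mul (pullbackHom _) _ _

theorem act_lift (θ : VectorField n) (f : Germs (Option (Fin n))) :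
    θ.lift.act f = ∑ i, pullback (θ i) * partialDeriv (some i) f := by
  rw [VectorField.lift, map_sum, LinearMap.sum_apply]
  rfl

theorem lift_mul_ofGerm (θ : VectorField n) (f : Germs (Option (Fin n))) :
    θ.lift * ofGerm f = ofGerm f * θ.lift + ofGerm (θ.lift.act f) := by
  refine DiffOp.ext fun g => ?_
  rw [map_add, LinearMap.add_apply]
  simp only [act_mul, act_ofGerm, act_lift, partialDeriv_mul, Finset.mul_sum, Finset.sum_mul,
    ← Finset.sum_add_distrib]
  exact Finset.sum_congr rfl fun i _ => by ring

theorem act_lift_pullback (θ : VectorField n) (f : Germs (Fin n)) :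
    θ.lift.act (pullback f) = pullback (θ.apply f) := by
  rw [act_lift, VectorField.apply, ← pullbackHom_apply (∑ i, θ i * partialDeriv i f), map_sum]
  refine Finset.sum_congr rfl fun i _ => ?_
  rw [partialDeriv_some_pullback, map_mul]
  rfl

theorem act_lift_coord_none (θ : VectorField n) : θ.lift.act (coord none) = 0 := by
  rw [act_lift]
  refine Finset.sum_eq_zero fun i _ => ?_
  rw [partialDeriv_coord, if_neg (by simp), mul_zero]

theorem act_lift_one (θ : VectorField n) : θ.lift.act 1 = 0 := by
  rw [act_lift]
  exact Finset.sum_eq_zero fun i _ => by rw [partialDeriv_one, mul_zero]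

theorem lift_commute_del_none (θ : VectorField n) :
    θ.lift * del none = del none * θ.lift := by
  simp only [VectorField.lift, Finset.sum_mul, Finset.mul_sum]
  refine Finset.sum_congr rfl fun i _ => ?_
  rw [mul_assoc, (del_commute (some i) none).eq, ← mul_assoc, ← mul_assoc, del_mul_ofGerm,
    partialDeriv_none_pullback, ofGerm_zero, add_zero]

/-- The commutator of vector fields. -/
def vfBracket (θ η : VectorField n) : VectorField n :=
  fun i => θ.apply (η i) - η.apply (θ i)

theorem lift_mul_lift (θ η : VectorField n) :
    θ.lift * η.lift = η.lift * θ.lift + (vfBracket θ η).lift := by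
  refine DiffOp.ext fun f => ?_
  rw [map_add, LinearMap.add_apply, act_mul, act_mul]
  have key : ∀ θ η : VectorField n, θ.lift.act (η.lift.act f) =
      ∑ i, pullback (θ.apply (η i)) * partialDeriv (some i) f +
      ∑ i, ∑ j, pullback (θ i) * pullback (η j) *
        partialDeriv (some i) (partialDeriv (some j) f) := by
    intro θ η
    rw [act_lift η, map_sum]
    have : ∀ j, θ.lift.act (pullback (η j) * partialDeriv (some j) f) =
        pullback (θ.apply (η j)) * partialDeriv (some j) f +
        ∑ i, pullback (θ i) * pullback (η j) *
          partialDeriv (some i) (partialDeriv (some j) f) := by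
      intro j
      rw [← act_lift_pullback, act_lift, act_lift, Finset.sum_mul, ← Finset.sum_add_distrib]
      refine Finset.sum_congr rfl fun i _ => ?_
      rw [partialDeriv_mul]
      ring
    rw [Finset.sum_congr rfl fun j _ => this j, Finset.sum_add_distrib, Finset.sum_comm]
  have hD : ∑ i, ∑ j, pullback (θ i) * pullback (η j) *
        partialDeriv (some i) (partialDeriv (some j) f) =
      ∑ i, ∑ j, pullback (η i) * pullback (θ j) *
        partialDeriv (some i) (partialDeriv (some j) f) := by
    rw [Finset.sum_comm]
    refine Finset.sum_congr rfl fun i _ => Finset.sum_congr rfl fun j _ => ?_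
    rw [partialDeriv_comm, mul_comm (pullback (θ j))]
  have hB : ∑ i, pullback (θ.apply (η i)) * partialDeriv (some i) f =
      ∑ i, pullback (η.apply (θ i)) * partialDeriv (some i) f +
        ∑ i, pullback (vfBracket θ η i) * partialDeriv (some i) f := by
    rw [← Finset.sum_add_distrib]
    refine Finset.sum_congr rfl fun i _ => ?_
    rw [← add_mul, vfBracket, ← pullbackHom_apply (_ - _), map_sub, ← pullbackHom_apply,
      ← pullbackHom_apply, add_sub_cancel]
  rw [key θ η, key η θ, act_lift (vfBracket θ η), hB, hD]
  ring

theorem vfBracket_apply (θ η : VectorField n) (f : Germs (Fin n)) :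
    (vfBracket θ η).apply f = θ.apply (η.apply f) - η.apply (θ.apply f) := by
  apply pullback_injective
  have h := congrArg (fun P : DiffOp (Option (Fin n)) => P.act (pullback f)) (lift_mul_lift θ η)
  simp only [map_add, LinearMap.add_apply, act_mul, act_lift_pullback] at h
  rw [← pullbackHom_apply (_ - _), map_sub]
  exact (sub_eq_of_eq_add' h).symm

end VectorFields

/-- The vector fields annihilating `h` are spanned by the basis elements annihilating `h`. -/
theorem mem_span_of_apply_eq_zero {m : ℕ} {h : Germs (Fin (m + 1))} (hh : h ≠ 0)
    {δ : Fin m → VectorField (m + 1)} {χ : VectorField (m + 1)}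
    (hbasis : IsLogBasis h (Fin.snoc (α := fun _ => VectorField (m + 1)) δ χ))
    (hδ : ∀ i, (δ i).apply h = 0) (hχ : χ.apply h = h) {θ : VectorField (m + 1)}
    (hθ : θ.apply h = 0) : θ ∈ Submodule.span (Germs (Fin (m + 1))) (Set.range δ) := by
  have h1 : θ ∈ logVectorFields h := by
    change θ.apply h ∈ Ideal.span {h}
    rw [hθ]
    exact zero_mem _
  rw [← hbasis.2, Submodule.mem_span_range_iff_exists_fun] at h1
  obtain ⟨c, rfl⟩ := h1
  rw [Fin.sum_univ_castSucc] at hθ ⊢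
  simp only [Fin.snoc_castSucc, Fin.snoc_last] at hθ ⊢
  rw [apply_add, apply_sum, Finset.sum_eq_zero fun i _ => by rw [apply_smul, hδ, mul_zero],
    zero_add, apply_smul, hχ] at hθ
  rw [(mul_eq_zero.1 hθ).resolve_right hh, zero_smul, add_zero]
  exact sum_mem fun i _ => Submodule.smul_mem _ _ (Submodule.subset_span ⟨i, rfl⟩)

section LinearType

variable {m : ℕ} {h : Germs (Fin (m + 1))} {δ : Fin m → VectorField (m + 1)}
  {χ : VectorField (m + 1)}

theorem symbol_mem_span {θ : VectorField (m + 1)}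
    (hθ : θ ∈ Submodule.span (Germs (Fin (m + 1))) (Set.range δ)) :
    θ.symbol ∈ Ideal.span (Set.range fun i => (δ i).symbol) := by
  induction hθ using Submodule.span_induction with
  | mem θ hθ =>
    obtain ⟨i, rfl⟩ := hθ
    exact Ideal.subset_span ⟨i, rfl⟩
  | zero =>
    rw [show (0 : VectorField (m + 1)).symbol = 0 from map_zero (symbolHom _)]
    exact zero_mem _
  | add θ η _ _ hθ hη =>
    rw [show (θ + η).symbol = θ.symbol + η.symbol from map_add (symbolHom _) θ η]
    exact add_mem hθ hη
  | smul a θ _ hθ =>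
    rw [show (a • θ).symbol = a • θ.symbol from map_smul (symbolHom _) a θ]
    exact Submodule.smul_of_tower_mem _ a hθ

/-- The components of the Jacobian syzygies: `h ξ_i ≡ (∂h/∂x_i) σ(χ)` modulo the symbols of the
vector fields annihilating `h`. -/
theorem C_mul_X_sub_mem (hh : h ≠ 0)
    (hbasis : IsLogBasis h (Fin.snoc (α := fun _ => VectorField (m + 1)) δ χ))
    (hδ : ∀ i, (δ i).apply h = 0) (hχ : χ.apply h = h) (i : Fin (m + 1)) :
    MvPolynomial.C h * MvPolynomial.X (some i) -
      MvPolynomial.C (partialDeriv i h) * χ.symbol ∈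
        Ideal.span (Set.range fun i => (δ i).symbol) := by
  have h0 : VectorField.apply (Pi.single i 1) h = partialDeriv i h := by
    simp [VectorField.apply, Pi.single_apply]
  have h1 : VectorField.apply (h • Pi.single i 1 - partialDeriv i h • χ) h = 0 := by
    rw [sub_eq_add_neg, ← neg_smul, apply_add, apply_smul, apply_smul, hχ, h0]
    ring
  have h2 := symbol_mem_span (mem_span_of_apply_eq_zero hh hbasis hδ hχ h1)
  have h3 : VectorField.symbol (h • Pi.single i 1 - partialDeriv i h • χ) =
      h • VectorField.symbol (Pi.single i 1) - partialDeriv i h • χ.symbol := by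
    have := map_sub (symbolHom (m + 1)) (h • Pi.single i 1) (partialDeriv i h • χ)
    rw [map_smul, map_smul] at this
    exact this
  have h4 : VectorField.symbol (Pi.single i 1 : VectorField (m + 1)) =
      MvPolynomial.X (some i) := by
    simp [VectorField.symbol, Pi.single_apply, apply_ite MvPolynomial.C]
  rwa [h3, h4, MvPolynomial.smul_eq_C_mul, MvPolynomial.smul_eq_C_mul] at h2

theorem _root_.MvPolynomial.IsHomogeneous.aeval_C_mul_X {κ R : Type*} [CommRing R]
    {p : MvPolynomial κ R} {l : ℕ} (hp : p.IsHomogeneous l) (r : R) :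
    MvPolynomial.aeval (fun i => MvPolynomial.C r * MvPolynomial.X i) p =
      MvPolynomial.C (r ^ l) * p := by
  conv_rhs => rw [p.as_sum]
  conv_lhs => rw [p.as_sum]
  rw [map_sum, Finset.mul_sum]
  refine Finset.sum_congr rfl fun α hα => ?_
  have hα' : α.degree = l := by
    rw [Finsupp.degree_eq_weight_one]
    exact hp (MvPolynomial.mem_support_iff.1 hα)
  rw [MvPolynomial.aeval_monomial, MvPolynomial.monomial_eq, MvPolynomial.algebraMap_eq,
    ← hα', map_pow]
  simp only [mul_pow, Finsupp.prod_mul]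
  rw [show (α.prod fun _ k => (MvPolynomial.C r : MvPolynomial κ R) ^ k) =
    MvPolynomial.C r ^ α.degree from Finset.prod_pow_eq_pow_sum _ _ _]
  ring

/-- A homogeneous polynomial vanishing at all the differentials `d (b h + c t)` lies in the ideal
generated by the symbols of the vector fields annihilating `h`; this says that the Jacobian ideal
is of linear type. -/
theorem mem_span_of_eval_eq_zero (hh : h ≠ 0)
    (hbasis : IsLogBasis h (Fin.snoc (α := fun _ => VectorField (m + 1)) δ χ))
    (hδ : ∀ i, (δ i).apply h = 0) (hχ : χ.apply h = h)
    (hreg : ∀ p, MvPolynomial.C h * p ∈ Ideal.span (Set.range fun i => (δ i).symbol) →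
      p ∈ Ideal.span (Set.range fun i => (δ i).symbol))
    {e : TotalGraded (m + 1)} {l : ℕ} (he : e.IsHomogeneous l)
    (h0 : ∀ b c : ℂ, MvPolynomial.eval (fun j : Option (Fin (m + 1)) =>
      j.elim (algebraMap ℂ _ c) fun i => algebraMap ℂ _ b * partialDeriv i h) e = 0) :
    e ∈ Ideal.span (Set.range fun i => (δ i).symbol) := by
  set J : Ideal (TotalGraded (m + 1)) := Ideal.span (Set.range fun i => (δ i).symbol) with hJ
  -- the polynomial `e (z dh, y)` in the two variables `z = X true` and `y = X false`
  let g : Option (Fin (m + 1)) → MvPolynomial Bool (Germs (Fin (m + 1))) :=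
    fun j => j.elim (MvPolynomial.X false) fun i =>
      MvPolynomial.C (partialDeriv i h) * MvPolynomial.X true
  have hE : MvPolynomial.aeval g e = 0 := by
    -- it vanishes at all points with constant coordinates, and there are infinitely many constants
    refine MvPolynomial.funext_set (fun _ => Set.range (algebraMap ℂ (Germs (Fin (m + 1)))))
      (fun _ => Set.infinite_range_of_injective (algebraMap ℂ (Germs (Fin (m + 1)))).injective)
      fun x hx => ?_
    obtain ⟨b, hb⟩ := hx true trivial
    obtain ⟨c, hc⟩ := hx false trivial
    have h1 := MvPolynomial.comp_aeval_apply (f := g)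
      (MvPolynomial.aeval (R := Germs (Fin (m + 1))) x) e
    rw [MvPolynomial.aeval_eq_eval, MvPolynomial.aeval_eq_eval] at h1
    rw [map_zero]
    refine h1.trans (Eq.trans ?_ (h0 b c))
    congr 2
    funext j
    cases j with
    | none => exact (MvPolynomial.eval_X _).trans hc.symm
    | some i => simp [g, ← hb, mul_comm]
  have hpow : MvPolynomial.C (h ^ l) * e ∈ J := by
    rw [← he.aeval_C_mul_X h, ← Ideal.Quotient.eq_zero_iff_mem]
    -- modulo `J`, replacing `ξ` by `h ξ` in `e` gives the value of `e (z dh, y)` at `z = σ(χ)`,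
    -- `y = h ξ_t`
    let ψ : MvPolynomial Bool (Germs (Fin (m + 1))) →ₐ[Germs (Fin (m + 1))] TotalGraded (m + 1) :=
      MvPolynomial.aeval fun b =>
        bif b then χ.symbol else MvPolynomial.C h * MvPolynomial.X none
    have h1 := MvPolynomial.comp_aeval_apply (f := fun j : Option (Fin (m + 1)) =>
      MvPolynomial.C h * MvPolynomial.X j) (Ideal.Quotient.mkₐ (Germs (Fin (m + 1))) J) e
    have h2 := MvPolynomial.comp_aeval_apply (f := g)
      ((Ideal.Quotient.mkₐ (Germs (Fin (m + 1))) J).comp ψ) e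
    rw [hE, map_zero] at h2
    refine h1.trans (Eq.trans ?_ h2.symm)
    congr 2
    funext j
    cases j with
    | none => simp [g, ψ]
    | some i =>
      have h3 : ψ (g (some i)) = MvPolynomial.C (partialDeriv i h) * χ.symbol := by
        simp [g, ψ, MvPolynomial.algebraMap_eq]
      rw [AlgHom.comp_apply, h3]
      exact Ideal.Quotient.eq.2 (C_mul_X_sub_mem hh hbasis hδ hχ i)
  clear he h0 hE
  induction l with
  | zero => simpa using hpow
  | succ l ih =>
    apply ih
    apply hreg
    rwa [← mul_assoc, ← map_mul, ← pow_succ']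

end LinearType

/-! ### Symbols of left ideals -/

section Symbols

variable {σ : Type}

/-- The operator `P` has coefficients polynomial in `t`, order at most `d`, and its symbol of
order `d` is `π`. -/
def HasSymbol (P : DiffOp (Option σ)) (d : ℤ) (π : SymbolRing σ) : Prop :=
  π ∈ homog σ d ∧ ∃ p, P = normalOp σ p ∧ p - π ∈ ordLE σ (d - 1)

theorem HasSymbol.add_one {P : DiffOp (Option σ)} {π : SymbolRing σ} (hP : HasSymbol P 1 π) :
    HasSymbol (P + 1) 1 π := by
  obtain ⟨hπ, p, rfl, hp⟩ := hP
  refine ⟨hπ, p + term 0 0 1, ?_, ?_⟩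
  · rw [map_add, normalOp_term, dpow_zero, pow_zero, ← pullbackHom_apply, map_one, one_mul,
      ofGerm_one, one_mul]
  · rw [add_sub_right_comm]
    exact add_mem hp (term_mem_bisupp 1 (by simp [bidegree]))

theorem HasSymbol.exists_eq_mul {P : DiffOp (Option σ)} {d : ℤ} {π : SymbolRing σ}
    (hP : HasSymbol P d π) {j : ℤ} {a : SymbolRing σ} (ha : a ∈ ordLE σ j) :
    ∃ b, normalOp σ b = normalOp σ a * P ∧ a * π - b ∈ ordLE σ (j + d - 1) := by
  obtain ⟨hπ, p, rfl, hp⟩ := hP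
  have hp' : p ∈ ordLE σ d := by
    rw [← sub_add_cancel p π]
    exact add_mem (ordLE_mono (by omega) hp) (homog_le_ordLE d hπ)
  obtain ⟨r, hr, h⟩ := exists_normalOp_mul_normalOp ha hp'
  refine ⟨a * p + r, h.symm, ?_⟩
  have h1 : a * (p - π) ∈ ordLE σ (j + d - 1) := by
    refine mul_mem_bisupp ha hp fun s hs t ht => ?_
    simp only [Set.mem_ofPred_eq, Prod.snd_add] at hs ht ⊢
    omega
  have h2 : a * π - (a * p + r) = -(a * (p - π) + r) := by ring
  rw [h2]
  exact neg_mem (add_mem h1 hr)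

theorem sub_bproj_mem_ordLE {j : ℤ} {b : SymbolRing σ} (hb : b ∈ ordLE σ j) :
    b - bproj {s | s.2 = j} b ∈ ordLE σ (j - 1) := by
  refine bisupp_mono ?_ (sub_bproj_mem (S := {s | s.2 = j}) hb)
  rintro s ⟨hs, hs'⟩
  simp only [Set.mem_ofPred_eq, Set.mem_compl_iff] at hs hs' ⊢
  omega

/-- The products of the operators with coefficients polynomial in `t` with a fixed operator. -/
def leftMultiples (P : DiffOp (Option σ)) : AddSubgroup (DiffOp (Option σ)) :=
  ((AddMonoidHom.mulRight P).comp (normalOp σ)).range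

theorem normalOp_mul_mem_leftMultiples (P : DiffOp (Option σ)) (b : SymbolRing σ) :
    normalOp σ b * P ∈ leftMultiples P := ⟨b, rfl⟩

/-- The symbols of the elements of `L` lie in the ideal `K`. -/
def SymbolsIn (L : AddSubgroup (DiffOp (Option σ))) (K : Ideal (SymbolRing σ)) : Prop :=
  ∀ l : ℤ, ∀ e ∈ homog σ l, ∀ x ∈ L, normalOp σ e - x ∈ orderFiltration (Option σ) (l - 1) → e ∈ K

/-- Every homogeneous element of `K` is the symbol of an element of `L`. -/
def SymbolsLift (L : AddSubgroup (DiffOp (Option σ))) (K : Ideal (SymbolRing σ)) : Prop :=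
  ∀ l : ℤ, ∀ e ∈ homog σ l, e ∈ K → ∃ b, normalOp σ b ∈ L ∧ e - b ∈ ordLE σ (l - 1)

/-- Adjoining to `L` the multiples of an operator `P` whose symbol `π` is regular modulo the symbols
of `L` only adjoins the multiples of `π` to the symbols. The top order part of the cofactor of `P`
in a relation that cancels the symbols lies in `K`, hence is the symbol of an element of `L'`, and
`L' P ⊆ L` allows to absorb it into `L`. -/
theorem SymbolsIn.sup_leftMultiples {L L' : AddSubgroup (DiffOp (Option σ))}
    {K : Ideal (SymbolRing σ)} (hL : SymbolsIn L K) (hL' : SymbolsLift L' K)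
    {P : DiffOp (Option σ)} {d : ℤ} {π : SymbolRing σ} (hP : HasSymbol P d π)
    (hLP : ∀ x ∈ L', x * P ∈ L) (hreg : ∀ u, u * π ∈ K → u ∈ K) :
    SymbolsIn (L ⊔ leftMultiples P) (K ⊔ Ideal.span {π}) := by
  have htop : ∀ (j : ℤ) (b : SymbolRing σ), b ∈ ordLE σ j → ∃ r ∈ ordLE σ (j + d - 1),
      normalOp σ b * P = normalOp σ (bproj {s | s.2 = j} b * π + r) := by
    intro j b hb
    obtain ⟨c, hc, hc'⟩ := hP.exists_eq_mul hb
    refine ⟨(b - bproj {s | s.2 = j} b) * π - (b * π - c), sub_mem ?_ hc', ?_⟩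
    · refine mul_mem_bisupp (sub_bproj_mem_ordLE hb) hP.1 fun s hs t ht => ?_
      simp only [Set.mem_ofPred_eq, Prod.snd_add] at hs ht ⊢
      omega
    · rw [← hc]
      congr 1
      ring
  have hhom : ∀ (j : ℤ) (b : SymbolRing σ), bproj {s | s.2 = j} b * π ∈ homog σ (j + d) := by
    intro j b
    refine mul_mem_bisupp (bproj_mem_self _ b) hP.1 fun s hs t ht => ?_
    simp only [Set.mem_ofPred_eq, Prod.snd_add] at hs ht ⊢
    omega
  intro l e he x hx hex
  obtain ⟨y, hy, z, ⟨b, rfl⟩, rfl⟩ := AddSubgroup.mem_sup.1 hx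
  obtain ⟨j, hj⟩ : ∃ j : ℕ, b ∈ ordLE σ (l - d + j) := by
    obtain ⟨n, hn⟩ := exists_mem_ordLE b
    exact ⟨(n - (l - d)).toNat, ordLE_mono (by omega) hn⟩
  change normalOp σ e - (y + normalOp σ b * P) ∈ _ at hex
  clear hx
  induction j generalizing b y with
  | zero =>
    -- the symbol of the cofactor times `π` has the order of `e`: no cancellation takes place
    rw [Nat.cast_zero, add_zero] at hj
    obtain ⟨r, hr, hbr⟩ := htop _ b hj
    have h1 : e - bproj {s | s.2 = l - d} b * π ∈ K := by
      refine hL l _ (sub_mem he ?_) y hy ?_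
      · have := hhom (l - d) b
        rwa [sub_add_cancel] at this
      · have h2 := normalOp_mem_orderFiltration hr
        rw [sub_add_cancel] at h2
        have h3 := add_mem hex h2
        rw [hbr, map_add] at h3
        rw [map_sub]
        convert h3 using 1
        abel
    rw [← sub_add_cancel e (bproj {s | s.2 = l - d} b * π)]
    exact Submodule.add_mem_sup h1 (Ideal.mem_span_singleton'.2 ⟨_, rfl⟩)
  | succ j ih =>
    obtain ⟨q, hq⟩ : ∃ q : ℤ, q = l - d + (j + 1 : ℕ) := ⟨_, rfl⟩
    rw [← hq] at hj
    -- the part of order `q` of the cofactor is cancelled by `y ∈ L`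
    obtain ⟨r, hr, hbr⟩ := htop _ b hj
    have h1 : -(bproj {s | s.2 = q} b * π) ∈ K := by
      refine hL (q + d) _ (neg_mem (hhom q b)) y hy ?_
      have h2 := normalOp_mem_orderFiltration hr
      have h3 := orderFiltration_mono (l' := q + d - 1) (by omega)
        (normalOp_mem_orderFiltration (homog_le_ordLE l he))
      have h4 := orderFiltration_mono (l' := q + d - 1) (by omega) hex
      have h5 := sub_mem (add_mem h4 h2) h3
      rw [hbr, map_add] at h5
      rw [map_neg]
      convert h5 using 1
      abel
    obtain ⟨c, hc, hc'⟩ := hL' q _ (bproj_mem_self _ b) (hreg _ (neg_mem_iff.1 h1))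
    refine ih (y + normalOp σ c * P) (add_mem hy (hLP _ hc)) (b - c) ?_ ?_
    · have h2 := add_mem (sub_bproj_mem_ordLE hj) hc'
      rw [sub_add_sub_cancel] at h2
      exact ordLE_mono (by omega) h2
    · convert hex using 1
      rw [map_sub, sub_mul]
      abel

end Symbols

/-! ### The operators generating the ideal -/

section Generators

variable {m : ℕ} {h : Germs (Fin (m + 1))} {δ : Fin m → VectorField (m + 1)}
  {χ : VectorField (m + 1)}

/-- The left ideal generated by the vector fields `δ`. -/
def fieldIdeal (δ : Fin m → VectorField (m + 1)) : AddSubgroup (DiffOp (Option (Fin (m + 1)))) :=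
  (Submodule.span (DiffOp (Option (Fin (m + 1))))
    (Set.range fun i => (δ i).lift)).toAddSubgroup

/-- The operator `χ + ∂_t t`. -/
def eulerOp (χ : VectorField (m + 1)) : DiffOp (Option (Fin (m + 1))) :=
  χ.lift + del none * ofGerm (coord none)

theorem mul_mem_fieldIdeal (Q : DiffOp (Option (Fin (m + 1)))) {x : DiffOp (Option (Fin (m + 1)))}
    (hx : x ∈ fieldIdeal δ) : Q * x ∈ fieldIdeal δ :=
  Submodule.smul_mem (Submodule.span _ _) Q hx

theorem lift_mem_fieldIdeal (δ : Fin m → VectorField (m + 1)) (i : Fin m) :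
    (δ i).lift ∈ fieldIdeal δ :=
  Submodule.subset_span ⟨i, rfl⟩

theorem lift_mem_fieldIdeal_of_mem_span {θ : VectorField (m + 1)}
    (hθ : θ ∈ Submodule.span (Germs (Fin (m + 1))) (Set.range δ)) :
    θ.lift ∈ fieldIdeal δ := by
  induction hθ using Submodule.span_induction with
  | mem θ hθ =>
    obtain ⟨i, rfl⟩ := hθ
    exact lift_mem_fieldIdeal δ i
  | zero =>
    rw [show (0 : VectorField (m + 1)) = (0 : Germs (Fin (m + 1))) • 0 from (zero_smul _ _).symm,
      lift_smul, ← pullbackHom_apply, map_zero, ofGerm_zero, zero_mul]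
    exact zero_mem _
  | add θ η _ _ hθ hη =>
    rw [lift_add]
    exact add_mem hθ hη
  | smul a θ _ hθ =>
    rw [lift_smul]
    exact mul_mem_fieldIdeal _ hθ

/-- An operator that multiplies the generators into the left ideal on the right preserves it. -/
theorem mul_mem_fieldIdeal_of_forall {P : DiffOp (Option (Fin (m + 1)))}
    (hP : ∀ i, (δ i).lift * P ∈ fieldIdeal δ) {x : DiffOp (Option (Fin (m + 1)))}
    (hx : x ∈ fieldIdeal δ) : x * P ∈ fieldIdeal δ := by
  change x ∈ Submodule.span _ _ at hx
  induction hx using Submodule.span_induction with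
  | mem x hx =>
    obtain ⟨i, rfl⟩ := hx
    exact hP i
  | zero =>
    rw [zero_mul]
    exact zero_mem _
  | add x y _ _ hx hy =>
    rw [add_mul]
    exact add_mem hx hy
  | smul Q x _ hx =>
    rw [smul_eq_mul, mul_assoc]
    exact mul_mem_fieldIdeal _ hx

theorem mul_ofGerm_mem_fieldIdeal {γ : Germs (Option (Fin (m + 1)))}
    (hγ : ∀ i, (δ i).lift.act γ = 0) {x : DiffOp (Option (Fin (m + 1)))}
    (hx : x ∈ fieldIdeal δ) : x * ofGerm γ ∈ fieldIdeal δ := by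
  refine mul_mem_fieldIdeal_of_forall (fun i => ?_) hx
  rw [lift_mul_ofGerm, hγ, ofGerm_zero, add_zero]
  exact mul_mem_fieldIdeal _ (lift_mem_fieldIdeal δ i)

theorem act_one_of_mem_fieldIdeal {x : DiffOp (Option (Fin (m + 1)))} (hx : x ∈ fieldIdeal δ) :
    x.act 1 = 0 := by
  change x ∈ Submodule.span _ _ at hx
  induction hx using Submodule.span_induction with
  | mem x hx =>
    obtain ⟨i, rfl⟩ := hx
    exact act_lift_one _
  | zero => rw [map_zero, LinearMap.zero_apply]
  | add x y _ _ hx hy => rw [map_add, LinearMap.add_apply, hx, hy, add_zero]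
  | smul Q x _ hx => rw [smul_eq_mul, act_mul, hx, map_zero]

theorem mul_eulerOp_mem_fieldIdeal (hh : h ≠ 0)
    (hbasis : IsLogBasis h (Fin.snoc (α := fun _ => VectorField (m + 1)) δ χ))
    (hδ : ∀ i, (δ i).apply h = 0) (hχ : χ.apply h = h) {x : DiffOp (Option (Fin (m + 1)))}
    (hx : x ∈ fieldIdeal δ) : x * eulerOp χ ∈ fieldIdeal δ := by
  refine mul_mem_fieldIdeal_of_forall (fun i => ?_) hx
  rw [eulerOp, mul_add, lift_mul_lift, ← mul_assoc, lift_commute_del_none, mul_assoc,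
    lift_mul_ofGerm, act_lift_coord_none, ofGerm_zero, add_zero]
  refine add_mem (add_mem (mul_mem_fieldIdeal _ (lift_mem_fieldIdeal δ i)) ?_)
    (mul_mem_fieldIdeal _ (mul_mem_fieldIdeal _ (lift_mem_fieldIdeal δ i)))
  refine lift_mem_fieldIdeal_of_mem_span (mem_span_of_apply_eq_zero hh hbasis hδ hχ ?_)
  rw [vfBracket_apply, hχ, hδ, apply_zero, sub_zero]

theorem eulerOp_mul_graph (hχ : χ.apply h = h) :
    eulerOp χ * ofGerm (coord none - pullback h) =
      ofGerm (coord none - pullback h) * (eulerOp χ + 1) := by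
  classical
  have h1 : del (none : Option (Fin (m + 1))) * ofGerm (coord none) =
      ofGerm (coord none) * del none + 1 := by
    rw [del_mul_ofGerm, partialDeriv_coord, if_pos rfl, ofGerm_one]
  have h2 : del (none : Option (Fin (m + 1))) * ofGerm (coord none - pullback h) =
      ofGerm (coord none - pullback h) * del none + 1 := by
    rw [del_mul_ofGerm, map_sub, partialDeriv_coord, if_pos rfl, partialDeriv_none_pullback,
      sub_zero, ofGerm_one]
  have h3 : χ.lift * ofGerm (coord none - pullback h) =
      ofGerm (coord none - pullback h) * χ.lift - ofGerm (pullback h) := by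
    rw [lift_mul_ofGerm, map_sub, act_lift_coord_none, act_lift_pullback, hχ, zero_sub]
    exact (congrArg _ (map_neg (ofGermHom _) _)).trans (sub_eq_add_neg _ _).symm
  have h4 := ofGerm_sub (coord none) (pullback h)
  rw [eulerOp, h1, add_mul, h3, add_mul, one_mul, mul_assoc, h2, mul_add, mul_one, ← mul_assoc,
    ofGerm_commute, h4]
  noncomm_ring

theorem hasSymbol_lift (θ : VectorField (m + 1)) :
    HasSymbol θ.lift 1 (Polynomial.C θ.symbol) :=
  ⟨bisupp_mono (by simp) (C_symbol_mem θ), _, (normalOp_symbol θ).symm, by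
    simp only [sub_self, zero_mem]⟩

theorem term_euler : (term 1 (Finsupp.single none 1) 1 : SymbolRing (Fin (m + 1))) =
    Polynomial.C (MvPolynomial.X none) * Polynomial.X := by
  rw [Polynomial.C_mul_X_eq_monomial]
  rfl

theorem eulerSymbol_mem (χ : VectorField (m + 1)) :
    eulerSymbol χ.symbol ∈ bisupp (Fin (m + 1)) {(0, 1)} := by
  rw [eulerSymbol, ← term_euler]
  exact add_mem (C_symbol_mem χ) (term_mem_bisupp _ (by simp [bidegree]))

theorem hasSymbol_eulerOp (χ : VectorField (m + 1)) :
    HasSymbol (eulerOp χ) 1 (eulerSymbol χ.symbol) := by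
  classical
  have h1 : eulerOp χ = normalOp _ (eulerSymbol χ.symbol) + 1 := by
    rw [eulerSymbol, map_add, normalOp_symbol, ← term_euler, normalOp_term, dpow_single, pow_one,
      ← pullbackHom_apply, map_one, mul_one, add_assoc, eulerOp, del_mul_ofGerm,
      partialDeriv_coord, if_pos rfl, ofGerm_one]
  rw [h1]
  refine HasSymbol.add_one ⟨bisupp_mono (by simp) (eulerSymbol_mem χ), _, rfl, ?_⟩
  simp only [sub_self, zero_mem]

theorem hasSymbol_graph (h : Germs (Fin (m + 1))) :
    HasSymbol (ofGerm (coord none - pullback h)) 0 (Polynomial.X - germSymbol h) := by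
  have h1 : (Polynomial.X - germSymbol h : SymbolRing (Fin (m + 1))) =
      term 1 0 1 - term 0 0 h := by
    rw [← Polynomial.monomial_one_one_eq_X]
    rfl
  rw [h1]
  refine ⟨sub_mem (term_mem_bisupp _ (by simp [bidegree])) (term_mem_bisupp _ (by simp [bidegree])),
    term 1 0 1 - term 0 0 h, ?_, ?_⟩
  · rw [map_sub, normalOp_term, normalOp_term, dpow_zero, mul_one, mul_one, pow_one, pow_zero,
      one_mul, ← pullbackHom_apply 1, map_one, mul_one, ofGerm_sub]
  · rw [sub_self]
    exact zero_mem _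

end Generators

/-! ### The symbols of the ideal -/

section Base

variable {m : ℕ} {h : Germs (Fin (m + 1))} {δ : Fin m → VectorField (m + 1)}
  {χ : VectorField (m + 1)}

theorem adGerm_iterate_mem_fieldIdeal {γ : Germs (Option (Fin (m + 1)))}
    (hγ : ∀ i, (δ i).lift.act γ = 0) (l : ℕ) {x : DiffOp (Option (Fin (m + 1)))}
    (hx : x ∈ fieldIdeal δ) : (adGerm γ ^ l) x ∈ fieldIdeal δ := by
  induction l with
  | zero => exact hx
  | succ l ih =>
    rw [pow_succ', Module.End.mul_apply, adGerm_apply]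
    exact sub_mem (mul_ofGerm_mem_fieldIdeal hγ ih) (mul_mem_fieldIdeal _ ih)

/-- The symbols of the left ideal generated by the vector fields `δ` lie in the ideal generated by
their symbols. The fields `δ` commute with the functions `γ = b h + c t`, so iterated commutators
with `γ` map the left ideal to itself, and the symbol of an element of the left ideal vanishes at
`dγ`. -/
theorem symbolsIn_fieldIdeal (hh : h ≠ 0)
    (hbasis : IsLogBasis h (Fin.snoc (α := fun _ => VectorField (m + 1)) δ χ))
    (hδ : ∀ i, (δ i).apply h = 0) (hχ : χ.apply h = h)
    (hreg : ∀ p, MvPolynomial.C h * p ∈ Ideal.span (Set.range fun i => (δ i).symbol) →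
      p ∈ Ideal.span (Set.range fun i => (δ i).symbol)) :
    SymbolsIn (fieldIdeal δ)
      ((Ideal.span (Set.range fun i => (δ i).symbol)).map Polynomial.C) := by
  classical
  intro l e he x hx hex
  rcases lt_or_ge l 0 with hl | hl
  · rw [ordLE_of_neg hl (homog_le_ordLE l he)]
    exact zero_mem _
  lift l to ℕ using hl
  rw [Ideal.mem_map_C_iff]
  intro a
  refine mem_span_of_eval_eq_zero hh hbasis hδ hχ hreg (l := l) ?_ fun b c => ?_
  · intro α hα
    have h1 : ((α.degree : ℕ) : ℤ) = l := he a α hα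
    have h2 : α.degree = l := by exact_mod_cast h1
    rwa [Finsupp.degree_eq_weight_one] at h2
  · let γ : Germs (Option (Fin (m + 1))) :=
      algebraMap ℂ _ b * pullback h + algebraMap ℂ _ c * coord none
    let v : Option (Fin (m + 1)) → Germs (Fin (m + 1)) :=
      fun j => j.elim (algebraMap ℂ _ c) fun i => algebraMap ℂ _ b * partialDeriv i h
    have hv : ∀ j, partialDeriv j γ = pullback (v j) := by
      intro j
      simp only [γ, v, ← Algebra.smul_def, map_add, map_smul, partialDeriv_coord]
      cases j with
      | none =>
        rw [partialDeriv_none_pullback, if_pos rfl, smul_zero, zero_add, ← pullbackHom_apply]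
        exact (Algebra.algebraMap_eq_smul_one c).symm.trans (AlgHom.commutes _ c).symm
      | some i =>
        rw [partialDeriv_some_pullback, if_neg (by simp), smul_zero, add_zero, ← pullbackHom_apply,
          ← pullbackHom_apply]
        exact (map_smul (pullbackHom _) b _).symm
    have hγ : ∀ i, (δ i).lift.act γ = 0 := by
      intro i
      simp only [γ, ← Algebra.smul_def, map_add, map_smul, act_lift_pullback, act_lift_coord_none,
        hδ]
      rw [← pullbackHom_apply, map_zero, smul_zero, smul_zero, add_zero]
    have h1 := adGerm_iterate_eq_zero γ l hex
    rw [map_sub, sub_eq_zero, adGerm_iterate_normalOp hv he] at h1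
    have h2 := act_one_of_mem_fieldIdeal (adGerm_iterate_mem_fieldIdeal hγ l hx)
    rw [← h1, map_nsmul, LinearMap.smul_apply, act_ofGerm, mul_one,
      smul_eq_zero_iff_right (Nat.factorial_ne_zero l)] at h2
    have h3 := coeff_eq_zero_of_dvd_eval₂ (a + 1) _ 0 (h2.trans (mul_zero _).symm) a
      (Nat.lt_succ_self a)
    rwa [Polynomial.coeff_map] at h3

/-- A combination of operators with given symbols is again the operator of an element of the symbol
ring, with the expected leading part. -/
theorem exists_normalOp_eq_sum {σ κ : Type} [Fintype κ] {L : AddSubgroup (DiffOp (Option σ))}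
    {P : κ → DiffOp (Option σ)} {π : κ → SymbolRing σ} {d j : ℤ}
    (hP : ∀ i, HasSymbol (P i) d (π i)) {a : κ → SymbolRing σ} (ha : ∀ i, a i ∈ ordLE σ j)
    (hL : ∀ i, normalOp σ (a i) * P i ∈ L) :
    ∃ b, normalOp σ b = ∑ i, normalOp σ (a i) * P i ∧ normalOp σ b ∈ L ∧
      ∑ i, a i * π i - b ∈ ordLE σ (j + d - 1) := by
  choose b hb hb' using fun i => (hP i).exists_eq_mul (ha i)
  refine ⟨∑ i, b i, ?_, ?_, ?_⟩
  · rw [map_sum]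
    exact Finset.sum_congr rfl fun i _ => hb i
  · rw [map_sum]
    exact sum_mem fun i _ => by rw [hb]; exact hL i
  · rw [← Finset.sum_sub_distrib]
    exact sum_mem fun i _ => hb' i

theorem symbolsLift_fieldIdeal (δ : Fin m → VectorField (m + 1)) :
    SymbolsLift (fieldIdeal δ)
      ((Ideal.span (Set.range fun i => (δ i).symbol)).map Polynomial.C) := by
  intro l e he heK
  obtain ⟨a, ha, rfl⟩ := exists_bisupp_of_mem_map_C (fun i => C_symbol_mem (δ i)) he heK
  have ha' : ∀ i, a i ∈ ordLE (Fin (m + 1)) (l - 1) := fun i => by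
    refine bisupp_mono ?_ (ha i)
    intro s hs
    simp only [Set.mem_ofPred_eq, Prod.snd_add] at hs ⊢
    omega
  obtain ⟨b, -, hb, hb'⟩ := exists_normalOp_eq_sum (L := fieldIdeal δ)
    (fun i => hasSymbol_lift (δ i)) ha'
    (fun i => mul_mem_fieldIdeal _ (lift_mem_fieldIdeal δ i))
  exact ⟨b, hb, ordLE_mono (by omega) hb'⟩

theorem symbolsLift_sup_leftMultiples (δ : Fin m → VectorField (m + 1)) (χ : VectorField (m + 1)) :
    SymbolsLift (fieldIdeal δ ⊔ leftMultiples (eulerOp χ))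
      (eulerIdeal (fun i => (δ i).symbol) χ.symbol) := by
  intro l e he heK
  obtain ⟨a, b, ha, hb, rfl⟩ := exists_bisupp_of_mem_eulerIdeal (fun i => C_symbol_mem (δ i))
    (eulerSymbol_mem χ) he heK
  have hle : ∀ x ∈ bisupp (Fin (m + 1)) {s : ℤ × ℤ | s + (0, 1) ∈ {s : ℤ × ℤ | s.2 = l}},
      x ∈ ordLE (Fin (m + 1)) (l - 1) := fun x hx => by
    refine bisupp_mono ?_ hx
    intro s hs
    simp only [Set.mem_ofPred_eq, Prod.snd_add] at hs ⊢
    omega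
  obtain ⟨c, -, hc, hc'⟩ := exists_normalOp_eq_sum (L := fieldIdeal δ)
    (fun i => hasSymbol_lift (δ i)) (fun i => hle _ (ha i))
    (fun i => mul_mem_fieldIdeal _ (lift_mem_fieldIdeal δ i))
  obtain ⟨g, hg, hg'⟩ := (hasSymbol_eulerOp χ).exists_eq_mul (hle _ hb)
  refine ⟨c + g, ?_, ?_⟩
  · rw [map_add, hg]
    exact AddSubgroup.add_mem_sup hc (normalOp_mul_mem_leftMultiples _ _)
  · rw [add_sub_add_comm]
    exact ordLE_mono (by omega) (add_mem hc' hg')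

end Base

/-! ### The order and V-filtrations on the ideal -/

section Main

variable {m : ℕ} {h : Germs (Fin (m + 1))} {δ : Fin m → VectorField (m + 1)}
  {χ : VectorField (m + 1)}

/-- The part of the strong Koszul hypothesis that is used: `h` is regular modulo the symbols of the
vector fields annihilating `h`. -/
theorem mem_span_symbol_of_C_mul_mem (hSK : IsStronglyKoszulFree h)
    (hbasis : IsLogBasis h (Fin.snoc (α := fun _ => VectorField (m + 1)) δ χ))
    (hδ : ∀ i, (δ i).apply h = 0) (hχ : χ.apply h = h) (p : TotalGraded (m + 1))
    (hp : MvPolynomial.C h * p ∈ Ideal.span (Set.range fun i => (δ i).symbol)) :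
    p ∈ Ideal.span (Set.range fun i => (δ i).symbol) := by
  have h1 := (hSK.2 _ (Fin.snoc (α := fun _ => Germs (Fin (m + 1))) (fun _ => 0) 1) hbasis
    (fun i => by
      refine Fin.lastCases ?_ (fun i => ?_) i
      · simp only [Fin.snoc_last, hχ, one_mul]
      · simp only [Fin.snoc_castSucc, hδ, zero_mul])).toIsWeaklyRegular
  rw [List.ofFn_succ', List.concat_eq_append, ← List.cons_append] at h1
  have h2 := ((RingTheory.Sequence.isWeaklyRegular_append_iff _ _ _).1 h1).1
  simp only [Fin.snoc_castSucc, map_zero, zero_mul, sub_zero] at h2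
  have h3 : Ideal.ofList (List.ofFn fun i => (δ i).symbol) =
      Ideal.span (Set.range fun i => (δ i).symbol) := by
    rw [Ideal.ofList]
    congr 1
    ext x
    simp [List.mem_ofFn]
  rw [← h3] at hp ⊢
  exact mem_ofList_of_mul_mem h2 hp

/-- The elements of the left ideal `I(h)` that are obtained with cofactors polynomial in `t`. -/
def polyIdeal (h : Germs (Fin (m + 1))) (δ : Fin m → VectorField (m + 1))
    (χ : VectorField (m + 1)) : AddSubgroup (DiffOp (Option (Fin (m + 1)))) :=
  fieldIdeal δ ⊔ leftMultiples (eulerOp χ + 1) ⊔ leftMultiples (ofGerm (coord none - pullback h))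

theorem normalOp_mul_lift_mem_polyIdeal (q : SymbolRing (Fin (m + 1))) (i : Fin m) :
    normalOp _ q * (δ i).lift ∈ polyIdeal h δ χ :=
  (le_sup_left.trans le_sup_left : fieldIdeal δ ≤ polyIdeal h δ χ)
    (mul_mem_fieldIdeal _ (lift_mem_fieldIdeal δ i))

theorem normalOp_mul_eulerOp_mem_polyIdeal (q : SymbolRing (Fin (m + 1))) :
    normalOp _ q * (eulerOp χ + 1) ∈ polyIdeal h δ χ :=
  (le_sup_right.trans le_sup_left : leftMultiples (eulerOp χ + 1) ≤ polyIdeal h δ χ)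
    (normalOp_mul_mem_leftMultiples _ q)

theorem normalOp_mul_graph_mem_polyIdeal (q : SymbolRing (Fin (m + 1))) :
    normalOp _ q * ofGerm (coord none - pullback h) ∈ polyIdeal h δ χ :=
  (le_sup_right : leftMultiples (ofGerm (coord none - pullback h)) ≤ polyIdeal h δ χ)
    (normalOp_mul_mem_leftMultiples _ q)

theorem polyIdeal_le : polyIdeal h δ χ ≤ (idealI h δ χ).toAddSubgroup := by
  refine sup_le (sup_le ?_ ?_) ?_
  · refine fun x hx => Submodule.span_mono ?_ hx
    exact fun y hy => Or.inl (Or.inr hy)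
  · rintro _ ⟨b, rfl⟩
    exact Submodule.smul_mem (idealI h δ χ) _ (Submodule.subset_span (Or.inr rfl))
  · rintro _ ⟨b, rfl⟩
    exact Submodule.smul_mem (idealI h δ χ) _ (Submodule.subset_span (Or.inl (Or.inl rfl)))

/-- The symbols of the elements of `polyIdeal` lie in the ideal generated by the symbols of the
generators: the generators form an involutive system. The multiples of the three kinds of generators
are adjoined one after the other; moving `χ + ∂_t t` past `t - h` turns it into `χ + ∂_t t + 1`. -/
theorem symbolsIn_polyIdeal (hSK : IsStronglyKoszulFree h)
    (hbasis : IsLogBasis h (Fin.snoc (α := fun _ => VectorField (m + 1)) δ χ))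
    (hδ : ∀ i, (δ i).apply h = 0) (hχ : χ.apply h = h) :
    SymbolsIn (polyIdeal h δ χ) (eulerIdeal (fun i => (δ i).symbol) χ.symbol ⊔
      Ideal.span {Polynomial.X - germSymbol h}) := by
  have hh : h ≠ 0 := hSK.1.1.1
  have hreg := mem_span_symbol_of_C_mul_mem hSK hbasis hδ hχ
  have hr : ∀ i, ∃ g₀ : MvPolynomial (Fin (m + 1)) (Germs (Fin (m + 1))),
      (δ i).symbol = MvPolynomial.rename some g₀ := fun i => symbol_eq_rename (δ i)
  have hX : ∀ p, MvPolynomial.X none * p ∈ Ideal.span (Set.range fun i => (δ i).symbol) →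
      p ∈ Ideal.span (Set.range fun i => (δ i).symbol) := fun p hp => by
    refine mem_of_X_none_mul_mem ?_ hp
    rintro _ ⟨i, rfl⟩
    exact hr i
  have h1 : SymbolsIn (fieldIdeal δ ⊔ leftMultiples (eulerOp χ + 1))
      (eulerIdeal (fun i => (δ i).symbol) χ.symbol) := by
    refine (symbolsIn_fieldIdeal hh hbasis hδ hχ hreg).sup_leftMultiples
      (symbolsLift_fieldIdeal δ) (hasSymbol_eulerOp χ).add_one (fun x hx => ?_)
      (fun u hu => mem_of_mul_eulerSymbol_mem hX hu)
    rw [mul_add, mul_one]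
    exact add_mem (mul_eulerOp_mem_fieldIdeal hh hbasis hδ hχ hx) hx
  refine h1.sup_leftMultiples (symbolsLift_sup_leftMultiples δ χ) (hasSymbol_graph h)
    (fun x hx => ?_) (fun u hu => mem_eulerIdeal_of_mul_graph_mem (fun i => C_symbol_mem (δ i))
      (eulerSymbol_mem χ) (fun u hu => mem_eulerIdeal_of_mul_germSymbol_mem hr hreg hu) hu)
  obtain ⟨y, hy, z, ⟨b, rfl⟩, rfl⟩ := AddSubgroup.mem_sup.1 hx
  rw [add_mul]
  refine AddSubgroup.add_mem_sup (mul_ofGerm_mem_fieldIdeal (fun i => ?_) hy) ?_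
  · rw [map_sub, act_lift_coord_none, act_lift_pullback, hδ, ← pullbackHom_apply, map_zero,
      sub_zero]
  · change normalOp _ b * eulerOp χ * ofGerm (coord none - pullback h) ∈ _
    obtain ⟨d, hd⟩ := exists_mem_ordLE b
    obtain ⟨c, hc, -⟩ := (hasSymbol_graph h).exists_eq_mul hd
    rw [mul_assoc, eulerOp_mul_graph hχ, ← mul_assoc, ← hc]
    exact normalOp_mul_mem_leftMultiples _ c

theorem lift_mem_vFiltration (θ : VectorField (m + 1)) :
    θ.lift ∈ vFiltration (none : Option (Fin (m + 1))) 0 :=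
  sum_mem fun i _ => by
    simpa using mul_mem_vFiltration (ofGerm_mem_vFiltration none (pullback (θ i)))
      (del_mem_vFiltration_of_ne (c := none) (Option.some_ne_none i))

theorem eulerOp_add_one_mem_vFiltration (χ : VectorField (m + 1)) :
    eulerOp χ + 1 ∈ vFiltration (none : Option (Fin (m + 1))) 0 :=
  add_mem (add_mem (lift_mem_vFiltration χ) (by
    simpa using mul_mem_vFiltration (del_mem_vFiltration none) (coord_mem_vFiltration none)))
    (one_mem_vFiltration _)

/-- The elements of `I(h)` are approximated, in the topology of the V-filtration, by elements
obtained with cofactors polynomial in `t`. -/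
theorem exists_normalOp_approx {A : DiffOp (Option (Fin (m + 1)))} (hA : A ∈ idealI h δ χ) :
    ∃ d : ℕ, ∀ N : ℕ, ∃ b, normalOp _ b ∈ polyIdeal h δ χ ∧
      A - normalOp _ b ∈ vFiltration (none : Option (Fin (m + 1))) (N - d) := by
  have hgen : ∀ (P : DiffOp (Option (Fin (m + 1)))) (j : ℤ) (π : SymbolRing (Fin (m + 1))),
      HasSymbol P j π → (∀ q, normalOp _ q * P ∈ polyIdeal h δ χ) →
      P ∈ vFiltration (none : Option (Fin (m + 1))) 0 → ∀ R : DiffOp (Option (Fin (m + 1))),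
      ∃ d : ℕ, ∀ N : ℕ, ∃ b, normalOp _ b ∈ polyIdeal h δ χ ∧
        R • P - normalOp _ b ∈ vFiltration (none : Option (Fin (m + 1))) (N - d) := by
    intro P j π hP hL hV R
    obtain ⟨d, hd⟩ := exists_mem_orderFiltration R
    refine ⟨d, fun N => ?_⟩
    obtain ⟨q, hq, E, hE, rfl⟩ := exists_truncation N hd
    obtain ⟨b, hb, -⟩ := hP.exists_eq_mul hq
    refine ⟨b, hb ▸ hL q, ?_⟩
    rw [smul_eq_mul, add_mul, hb, add_sub_cancel_left]
    have := mul_mem_vFiltration (mul_mem_vFiltration (coord_pow_mem_vFiltration none N)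
      (orderFiltration_le_vFiltration none d hE)) hV
    rwa [add_zero, ← sub_eq_add_neg] at this
  induction hA using Submodule.closure_induction with
  | zero => exact ⟨0, fun N => ⟨0, by rw [map_zero]; exact zero_mem _, by
      rw [map_zero, sub_zero]; exact zero_mem _⟩⟩
  | add A B _ _ hA hB =>
    obtain ⟨d, hA⟩ := hA
    obtain ⟨d', hB⟩ := hB
    refine ⟨max d d', fun N => ?_⟩
    obtain ⟨a, ha, ha'⟩ := hA N
    obtain ⟨b, hb, hb'⟩ := hB N
    refine ⟨a + b, ?_, ?_⟩
    · rw [map_add]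
      exact add_mem ha hb
    · rw [map_add, add_sub_add_comm]
      exact add_mem (vFiltration_anti _ (by omega) ha') (vFiltration_anti _ (by omega) hb')
  | smul_mem R P hP =>
    rcases hP with (rfl | ⟨i, rfl⟩) | rfl
    · exact hgen _ _ _ (hasSymbol_graph h) normalOp_mul_graph_mem_polyIdeal
        (ofGerm_mem_vFiltration _ _) R
    · exact hgen _ _ _ (hasSymbol_lift (δ i)) (fun q => normalOp_mul_lift_mem_polyIdeal q i)
        (lift_mem_vFiltration _) R
    · exact hgen _ _ _ (hasSymbol_eulerOp χ).add_one normalOp_mul_eulerOp_mem_polyIdeal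
        (eulerOp_add_one_mem_vFiltration χ) R

/-- An element of `V^k` that is congruent modulo `I(h)` to an operator of lower order `l` can be
changed modulo `I(h)`, within `V^k`, to lower its order to `l`: its symbol lies in the ideal
generated by the symbols of the generators, with cofactors of weight at least `k`, and
subtracting the corresponding element of `I(h)` kills it. -/
theorem exists_normalOp_order_le (hSK : IsStronglyKoszulFree h)
    (hbasis : IsLogBasis h (Fin.snoc (α := fun _ => VectorField (m + 1)) δ χ))
    (hδ : ∀ i, (δ i).apply h = 0) (hχ : χ.apply h = h) {k l : ℤ}
    {p : SymbolRing (Fin (m + 1))} (hp : p ∈ ordLE _ l) (j : ℕ)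
    {q : SymbolRing (Fin (m + 1))} (hq : q ∈ ordLE _ (l + j))
    (hqV : normalOp _ q ∈ vFiltration (none : Option (Fin (m + 1))) k)
    (hqp : normalOp _ q - normalOp _ p ∈ polyIdeal h δ χ) :
    ∃ q' ∈ ordLE _ l, normalOp _ q' ∈ vFiltration (none : Option (Fin (m + 1))) k ∧
      normalOp _ q' - normalOp _ p ∈ polyIdeal h δ χ := by
  induction j generalizing q with
  | zero => exact ⟨q, by simpa using hq, hqV, hqp⟩
  | succ j ih =>
    obtain ⟨o, ho⟩ : ∃ o : ℤ, o = l + (j + 1 : ℕ) := ⟨_, rfl⟩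
    rw [← ho] at hq
    obtain ⟨d, hd⟩ := exists_mem_ordLE q
    have hqe := sub_bproj_mem_ordLE hq
    have he' : bproj {s : ℤ × ℤ | s.2 = o} q ∈ bisupp _ {s : ℤ × ℤ | k ≤ s.1 ∧ s.2 = o} :=
      bproj_mem (mem_weightGE_of_normalOp_mem d k q hd hqV)
    have he : bproj {s : ℤ × ℤ | s.2 = o} q ∈ homog _ o := bproj_mem_self _ q
    generalize bproj {s : ℤ × ℤ | s.2 = o} q = e at hqe he he'
    have heK := symbolsIn_polyIdeal hSK hbasis hδ hχ o e he _ hqp (by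
      have h1 := normalOp_mem_orderFiltration hqe
      have h2 := normalOp_mem_orderFiltration (ordLE_mono (l' := o - 1) (by omega) hp)
      have h3 := sub_mem h2 h1
      rw [map_sub] at h3
      convert h3 using 1
      abel)
    obtain ⟨a, b, u, ha, hb, hu, hsum⟩ := exists_bisupp_of_mem_graph
      (fun i => C_symbol_mem (δ i)) (eulerSymbol_mem χ)
      (fun u hu => mem_eulerIdeal_of_mul_germSymbol_mem (fun i => symbol_eq_rename (δ i))
        (mem_span_symbol_of_C_mul_mem hSK hbasis hδ hχ) hu) he' heK
    have hord : ∀ (i : ℤ) (x : SymbolRing (Fin (m + 1))),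
        x ∈ bisupp _ {s : ℤ × ℤ | k ≤ s.1 ∧ s.2 = i} → x ∈ ordLE _ i := fun i x hx =>
      bisupp_mono (fun (s : ℤ × ℤ) (hs : k ≤ s.1 ∧ s.2 = i) => le_of_eq hs.2) hx
    have hV : ∀ (i : ℤ) (x : SymbolRing (Fin (m + 1))) (P : DiffOp (Option (Fin (m + 1)))),
        x ∈ bisupp _ {s : ℤ × ℤ | k ≤ s.1 ∧ s.2 = i} →
        P ∈ vFiltration (none : Option (Fin (m + 1))) 0 →
        normalOp _ x * P ∈ vFiltration (none : Option (Fin (m + 1))) k := fun i x P hx hP => by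
      have hx' : x ∈ weightGE _ k :=
        bisupp_mono (fun (s : ℤ × ℤ) (hs : k ≤ s.1 ∧ s.2 = i) => hs.1) hx
      simpa using mul_mem_vFiltration (normalOp_mem_vFiltration hx') hP
    obtain ⟨c, hc, hcL, hc'⟩ := exists_normalOp_eq_sum (L := polyIdeal h δ χ)
      (fun i => hasSymbol_lift (δ i)) (fun i => hord _ _ (ha i))
      (fun i => normalOp_mul_lift_mem_polyIdeal (a i) i)
    obtain ⟨g, hg, hg'⟩ := (hasSymbol_eulerOp χ).add_one.exists_eq_mul (hord _ _ hb)
    obtain ⟨w, hw, hw'⟩ := (hasSymbol_graph h).exists_eq_mul (hord _ _ hu)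
    have hL : normalOp _ (c + g + w) ∈ polyIdeal h δ χ := by
      rw [map_add, map_add, hg, hw]
      exact add_mem (add_mem hcL (normalOp_mul_eulerOp_mem_polyIdeal b))
        (normalOp_mul_graph_mem_polyIdeal u)
    have hLV : normalOp _ (c + g + w) ∈ vFiltration (none : Option (Fin (m + 1))) k := by
      rw [map_add, map_add, hc, hg, hw]
      exact add_mem (add_mem (sum_mem fun i _ => hV _ _ _ (ha i) (lift_mem_vFiltration _))
        (hV _ _ _ hb (eulerOp_add_one_mem_vFiltration χ)))
        (hV _ _ _ hu (ofGerm_mem_vFiltration _ _))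
    refine ih (q := q - (c + g + w)) ?_ ?_ ?_
    · have h1 := add_mem hqe (add_mem (add_mem (ordLE_mono (l' := o - 1) (by omega) hc')
        (ordLE_mono (l' := o - 1) (by omega) hg')) (ordLE_mono (l' := o - 1) (by omega) hw'))
      refine ordLE_mono (l := o - 1) (by omega) ?_
      convert h1 using 1
      rw [hsum]
      abel
    · rw [map_sub]
      exact sub_mem hqV hLV
    · rw [map_sub, sub_right_comm]
      exact sub_mem hqp hL

end Main

end SKFree

end

theorem mainTheorem7 {m : ℕ} (h : SKFree.Germs (Fin (m + 1)))
    (hSK : SKFree.IsStronglyKoszulFree h)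
    (δ : Fin m → SKFree.VectorField (m + 1)) (χ : SKFree.VectorField (m + 1))
    (hbasis : SKFree.IsLogBasis h (Fin.snoc (α := fun _ => SKFree.VectorField (m + 1)) δ χ))
    (hδ : ∀ i, (δ i).apply h = 0) (hχ : χ.apply h = h) (k l : ℤ) :
    Function.Surjective (SKFree.canonicalMap h δ χ k l) := by
  rintro ⟨_, ⟨P, hP, rfl⟩, ⟨Q, hQ, hQP⟩⟩
  have hA : P - Q ∈ SKFree.idealI h δ χ :=
    (Submodule.Quotient.eq _).1 (show Submodule.Quotient.mk P = Submodule.Quotient.mk Q from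
      hQP.symm)
  obtain ⟨d, hd⟩ := SKFree.exists_normalOp_approx hA
  -- `N` is so large that both the truncation error of `P` and the error in the approximation
  -- of `P - Q` lie in `V^k`
  obtain ⟨b, hb, hbV⟩ := hd (k.toNat + d + l.toNat)
  obtain ⟨p, hp, E, hE, rfl⟩ := SKFree.exists_truncation (k.toNat + d + l.toNat) hP
  have hEV := SKFree.mul_mem_vFiltration
    (SKFree.coord_pow_mem_vFiltration none (k.toNat + d + l.toNat))
    (SKFree.orderFiltration_le_vFiltration none l hE)
  have hbV' := SKFree.vFiltration_anti (k := k) _ (by push_cast; omega) hbV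
  have hEV' := SKFree.vFiltration_anti (k := k) _ (by push_cast; omega) hEV
  have hEF : SKFree.ofGerm (SKFree.coord none) ^ (k.toNat + d + l.toNat) * E ∈
      SKFree.orderFiltration _ l := by
    rw [← SKFree.ofGerm_pow]
    exact SKFree.ofGerm_mul_mem_orderFiltration _ hE
  generalize SKFree.ofGerm (SKFree.coord none) ^ (k.toNat + d + l.toNat) * E = R at *
  obtain ⟨n, hn⟩ := SKFree.exists_mem_ordLE (p - b)
  obtain ⟨q, hq, hqV, hqp⟩ := SKFree.exists_normalOp_order_le hSK hbasis hδ hχ (k := k) hp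
    ((n : ℤ) - l).toNat (q := p - b) (SKFree.ordLE_mono (by omega) hn)
    (by
      have h1 := sub_mem (add_mem hQ hbV') hEV'
      rw [map_sub]
      convert h1 using 1
      abel)
    (by
      rw [map_sub, sub_sub_cancel_left]
      exact neg_mem hb)
  have hI : SKFree.normalOp _ q + R - (SKFree.normalOp _ p + R) ∈ SKFree.idealI h δ χ := by
    rw [add_sub_add_right_eq_sub]
    exact SKFree.polyIdeal_le hqp
  exact ⟨⟨SKFree.normalOp _ q + R, add_mem (SKFree.normalOp_mem_orderFiltration hq) hEF,
    add_mem hqV hEV'⟩, Subtype.ext ((Submodule.Quotient.eq _).2 hI)⟩
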